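/- Let $G$ be a finite-dimensional real Lie group with a continuous homomorphism $\varepsilon\colon G\to\{\pm1\}$, Lie algebra $\mathfrak g$, and $G^\uparrow=\ker\varepsilon$. An element $x\in\mathfrak g$ is an Euler element if $\operatorname{ad}x$ is non-zero and diagonalizable with eigenvalues in $\{-1,0,1\}$. An Euler couple of $G$ is a pair $(x,\sigma)\in\mathfrak g\times G$ with $x$ an Euler element, $\varepsilon(\sigma)=-1$, $\sigma^2=e$, $\operatorname{Ad}(\sigma)x=x$ and $\operatorname{Ad}(\sigma)=e^{\pi i\operatorname{ad}x}$. The group acts on such pairs by $g.(x,\sigma)=(\varepsilon(g)\operatorname{Ad}(g)x,\;g\sigma g^{-1})$, and for $W=(x,\sigma)$ we put $\lambda_W(t)=\exp(tx)$. A standard subspace of a complex Hilbert space $\mathcal H$ is a closed real subspace $\mathsf V$ with $\mathsf V\cap i\mathsf V=\{0\}$ and $\mathsf V+i\mathsf V$ dense. Its Tomita operator $S_{\mathsf V}\colon \mathsf V+i\mathsf V\to \mathsf V+i\mathsf V$, $\xi+i\eta\mapsto\xi-i\eta$, has the polar decomposition $S_{\mathsf V}=J_{\mathsf V}\Delta_{\mathsf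 V}^{1/2}$, with $J_{\mathsf V}$ antiunitary and $\Delta_{\mathsf V}$ positive self-adjoint. Let $U$ be a strongly continuous (anti-)unitary representation of $G$ on $\mathcal H$, i.e. $U(g)$ is unitary for $\varepsilon(g)=1$ and antiunitary for $\varepsilon(g)=-1$. Let $H\subseteq G$ be a Lie subgroup with Lie algebra $\mathfrak h\subseteq\mathfrak g$, graded by $\varepsilon|_H$, and $H^\uparrow=H\cap G^\uparrow$. Let $W_1=(h_1,\tau_1)$ be an Euler couple of $H$ and $W_2=(h_2,\tau_2)$ an Euler couple of $G$, and assume that every $g\in H^\uparrow$ with $g.W_1=W_1$ satisfies $g.W_2=W_2$ (this implies $[h_1,h_2]=0$). Then: 1. There is a unique standard subspace $\mathsf N_2\subseteq\mathcal H$ (the Brunetti–Guido–Longo subspace of $W_2$) with $J_{\mathsf N_2}=U(\tau_2)$ and $\Delta_{\mathsf N_2}^{-it/2\pi}=U(\exp(th_2))$ for all $t\in\mathbb R$. 2. There is a unique map $\mathsf N$ from the orbit $\mathcal W_+=H^\uparrow.W_1$ to the set of standard subspaces of $\mathcal H$ with $\mathsf N(g.W_1)=U(g)\mathsf N_2$ for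 all $g\in H^\uparrow$. 3. The net $\mathsf N$ is modular covariant, i.e. $\Delta_{\mathsf N(W_a)}^{-it}\,\mathsf N(W_b)=\mathsf N(\lambda_{W_a}(2\pi t).W_b)$ for all $W_a,W_b\in\mathcal W_+$ and $t\in\mathbb R$, if and only if for all $g\in H^\uparrow$ and $t\in\mathbb R$ the operator $U(g)\,U(\exp(t(h_1-h_2)))\,U(g)^{-1}$ maps $\mathsf N_2$ onto itself, i.e. if and only if $$g\exp(t(h_1-h_2))g^{-1}\in G_{\mathsf N_2}:=\{x\in G: U(x)\mathsf N_2=\mathsf N_2\}\qquad\text{for all } g\in H^\uparrow,\ t\in\mathbb R.$$ -/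

import Mathlib

open scoped Manifold ContDiff

noncomputable section

namespace WedgeNet

/-! ### Lie groups: adjoint action and exponential function -/

section LieGroups

variable {E G : Type*} [NormedAddCommGroup E] [NormedSpace ℝ E]
  [TopologicalSpace G] [ChartedSpace E G] [Group G]

/-- The adjoint action `Ad(g)` of `G` on its Lie algebra: the derivative at `1` of the conjugation
`y ↦ g y g⁻¹`. -/
def Ad (g : G) (x : GroupLieAlgebra 𝓘(ℝ, E) G) : GroupLieAlgebra 𝓘(ℝ, E) G :=
  mfderiv 𝓘(ℝ, E) 𝓘(ℝ, E) (fun y : G => g * y * g⁻¹) 1 x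

/-- `γ` is the one-parameter group with initial velocity `x`: the integral curve through `1` of the
left-invariant vector field with value `x` at `1`. -/
def IsExpCurve (x : GroupLieAlgebra 𝓘(ℝ, E) G) (γ : ℝ → G) : Prop :=
  γ 0 = 1 ∧ IsMIntegralCurve (I := 𝓘(ℝ, E)) γ (mulInvariantVectorField x)

open Classical in
/-- The exponential function `exp(x) = γ(1)` of a Lie group, where `γ` is the one-parameter group
with initial velocity `x` (which exists and is unique in every Lie group). -/
def lieExp (x : GroupLieAlgebra 𝓘(ℝ, E) G) : G :=
  if h : ∃ γ : ℝ → G, IsExpCurve x γ then h.choose 1 else 1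

/-! ### Euler elements and abstract wedges -/

/-- `x` is an Euler element: `ad x` is non-zero and diagonalizable with eigenvalues in
`{1, 0, -1}`, i.e. the Lie algebra is the sum of `ker (ad x - 1)`, `ker (ad x)` and
`ker (ad x + 1)`. -/
def IsEulerElement (x : GroupLieAlgebra 𝓘(ℝ, E) G) : Prop :=
  (∃ y : GroupLieAlgebra 𝓘(ℝ, E) G, ⁅x, y⁆ ≠ 0) ∧
  ∀ y : GroupLieAlgebra 𝓘(ℝ, E) G, ∃ y₁ y₀ y₂ : GroupLieAlgebra 𝓘(ℝ, E) G,
    ⁅x, y₁⁆ = y₁ ∧ ⁅x, y₀⁆ = 0 ∧ ⁅x, y₂⁆ = -y₂ ∧ y = y₁ + y₀ + y₂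

/-- The abstract wedge space of a group graded by `ε`:
all pairs `(x, σ)` with `ε(σ) = -1`, `σ² = 1` and `Ad(σ) x = x`. -/
def wedgeSpace (ε : G →* ℤˣ) : Set (GroupLieAlgebra 𝓘(ℝ, E) G × G) :=
  {W | ε W.2 = -1 ∧ W.2 * W.2 = 1 ∧ Ad W.2 W.1 = W.1}

/-- The set of Euler couples: pairs `(x, σ)` in the abstract wedge space such that `x` is an Euler
element and `Ad(σ) = exp(π i ad x)`; the latter operator acts on the eigenspace
`ker (ad x - j)` as `(-1) ^ j`, for `j = 0, 1, -1`. -/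
def eulerCouples (ε : G →* ℤˣ) : Set (GroupLieAlgebra 𝓘(ℝ, E) G × G) :=
  {W | W ∈ wedgeSpace ε ∧ IsEulerElement W.1 ∧
    ∀ y : GroupLieAlgebra 𝓘(ℝ, E) G,
      (⁅W.1, y⁆ = 0 → Ad W.2 y = y) ∧
      (⁅W.1, y⁆ = y → Ad W.2 y = -y) ∧
      (⁅W.1, y⁆ = -y → Ad W.2 y = -y)}

/-- The action of `G` on its wedge space, `g.(x, σ) = (ε(g) Ad(g) x, g σ g⁻¹)`. -/
def wedgeAct (ε : G →* ℤˣ) (g : G) (W : GroupLieAlgebra 𝓘(ℝ, E) G × G) :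
    GroupLieAlgebra 𝓘(ℝ, E) G × G :=
  (((ε g : ℤ) : ℝ) • Ad g W.1, g * W.2 * g⁻¹)

/-- The positive wedge space of `W`: its orbit under the even subgroup `{g | ε g = 1}`. -/
def wedgeOrbit (ε : G →* ℤˣ) (W : GroupLieAlgebra 𝓘(ℝ, E) G × G) :
    Set (GroupLieAlgebra 𝓘(ℝ, E) G × G) :=
  {W' | ∃ g : G, ε g = 1 ∧ W' = wedgeAct ε g W}

/-- The one-parameter group `λ_W(t) = exp(t x)` of `W = (x, σ)`. -/
def wedgeFlow (W : GroupLieAlgebra 𝓘(ℝ, E) G × G) (t : ℝ) : G := lieExp (t • W.1)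

end LieGroups

/-! ### Modular objects of standard subspaces -/

section Modular

variable {K : Type*} [NormedAddCommGroup K] [InnerProductSpace ℂ K] [CompleteSpace K]

/-- The graph of the Tomita operator `S : V + iV → V + iV`, `ξ + iη ↦ ξ - iη`. -/
def tomitaGraph (V : StandardSubspace K) : Set (K × K) :=
  {p | ∃ ξ ∈ V.toClosedSubmodule, ∃ η ∈ V.toClosedSubmodule,
    p = (ξ + Complex.I • η, ξ - Complex.I • η)}

/-- `S = J T` is the polar decomposition of the Tomita operator `S` of `V`: `J` is antiunitary, `T`
is a positive self-adjoint operator, and the operators `S` and `J T` have the same graph. Thus `J`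
is the modular conjugation of `V`, and `T = Δ^{1/2}` for the modular operator `Δ` of `V`. -/
structure IsTomitaPolar (V : StandardSubspace K) (J : K ≃ₗᵢ⋆[ℂ] K) (T : K →ₗ.[ℂ] K) : Prop where
  dense : Dense (T.domain : Set K)
  selfAdjoint : IsSelfAdjoint T
  nonneg : ∀ ξ : T.domain, 0 ≤ (inner ℂ (ξ : K) (T ξ)).re
  graph : tomitaGraph V = {p | ∃ h : p.1 ∈ T.domain, J (T ⟨p.1, h⟩) = p.2}

/-- `u(t) = T^{it}` for a positive injective self-adjoint operator `T`: `u` is the strongly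
continuous one-parameter group of unitary operators whose analytic generator is `T`.
That is, `ξ` lies in the domain of `T` and `T ξ = η` if and only if the orbit map `t ↦ u(t) ξ`
extends to a continuous map on the strip `-1 ≤ Im z ≤ 0` that is holomorphic in its interior and
takes the value `η` at `z = -i` (where `T^{iz} = T`). -/
structure IsImaginaryPowers (T : K →ₗ.[ℂ] K) (u : ℝ → K ≃ₗᵢ[ℂ] K) : Prop where
  add : ∀ s t : ℝ, ∀ ξ : K, u (s + t) ξ = u s (u t ξ)
  continuous : ∀ ξ : K, Continuous fun t => u t ξ
  graph : ∀ ξ η : K, (∃ h : ξ ∈ T.domain, T ⟨ξ, h⟩ = η) ↔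
    ∃ F : ℂ → K, ContinuousOn F {z | -1 ≤ z.im ∧ z.im ≤ 0} ∧
      DifferentiableOn ℂ F {z | -1 < z.im ∧ z.im < 0} ∧
      (∀ t : ℝ, F t = u t ξ) ∧ F (-Complex.I) = η

/-- `J` is the modular conjugation of `V`, and `δ(t) = Δ^{it}` is its modular group. Here
`T = Δ^{1/2}`, so that `T^{it} = Δ^{it/2}`. -/
def IsModularPair (V : StandardSubspace K) (J : K ≃ₗᵢ⋆[ℂ] K) (δ : ℝ → K ≃ₗᵢ[ℂ] K) : Prop :=
  ∃ T : K →ₗ.[ℂ] K, IsTomitaPolar V J T ∧ IsImaginaryPowers T fun t => δ (t / 2)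

open Classical in
/-- The modular group `Δ_V^{it}` of the standard subspace `V` (it exists and is unique). -/
def modularGroup (V : StandardSubspace K) : ℝ → K ≃ₗᵢ[ℂ] K :=
  if h : ∃ δ : ℝ → K ≃ₗᵢ[ℂ] K, ∃ J : K ≃ₗᵢ⋆[ℂ] K, IsModularPair V J δ then h.choose
  else fun _ => LinearIsometryEquiv.refl ℂ K

/-- The image of a closed real subspace under a real-linear isometric bijection of `K` (such as
a unitary or an antiunitary operator). -/
def image (A : K ≃ₗᵢ[ℝ] K) (V : ClosedSubmodule ℝ K) : ClosedSubmodule ℝ K :=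
  V.mapEquiv A.toContinuousLinearEquiv

/-- A unitary operator as a real-linear isometric bijection. -/
def toReal (A : K ≃ₗᵢ[ℂ] K) : K ≃ₗᵢ[ℝ] K where
  toLinearEquiv := A.toLinearEquiv.restrictScalars ℝ
  norm_map' := A.norm_map

end Modular

/-! ### (Anti-)unitary representations, the Brunetti-Guido-Longo subspace, and nets -/

section Nets

variable {E G : Type*} [NormedAddCommGroup E] [NormedSpace ℝ E]
  [TopologicalSpace G] [ChartedSpace E G] [Group G]
  {K : Type*} [NormedAddCommGroup K] [InnerProductSpace ℂ K] [CompleteSpace K]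

/-- `U` is an (anti-)unitary representation of the group `G` graded by `ε`: a strongly continuous
homomorphism with `U(g)` unitary if `ε(g) = 1` and antiunitary if `ε(g) = -1`. -/
structure IsAntiunitaryRep (ε : G →* ℤˣ) (U : G →* (K ≃ₗᵢ[ℝ] K)) : Prop where
  even : ∀ g, ε g = 1 → ∀ (c : ℂ) (ξ : K), U g (c • ξ) = c • U g ξ
  odd : ∀ g, ε g = -1 → ∀ (c : ℂ) (ξ : K), U g (c • ξ) = (starRingEnd ℂ c) • U g ξ
  continuous : ∀ ξ : K, Continuous fun g => U g ξ

/-- `V` is the Brunetti-Guido-Longo subspace of `W = (x, σ)`, i.e. the standard subspace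
with `J_V = U(σ)` and `Δ_V^{-it/2π} = U(exp(t x))` for all real `t`. -/
def IsBGLSubspace (U : G →* (K ≃ₗᵢ[ℝ] K)) (W : GroupLieAlgebra 𝓘(ℝ, E) G × G)
    (V : StandardSubspace K) : Prop :=
  ∃ (J : K ≃ₗᵢ⋆[ℂ] K) (δ : ℝ → K ≃ₗᵢ[ℂ] K), IsModularPair V J δ ∧
    (∀ ξ, J ξ = U W.2 ξ) ∧
    ∀ (t : ℝ) (ξ : K), δ (-t / (2 * Real.pi)) ξ = U (lieExp (t • W.1)) ξ

/-- The stabilizer `{g | U(g) V = V}` of a standard subspace. -/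
def stabilizer (U : G →* (K ≃ₗᵢ[ℝ] K)) (V : StandardSubspace K) : Set G :=
  {g | image (U g) V.toClosedSubmodule = V.toClosedSubmodule}

/-- `N` is the net `g.W₁ ↦ U(g) N₂` on the positive wedge space of `W₁`, where `g` runs through
the even elements of the group. -/
def IsInducedNet (ε : G →* ℤˣ) (U : G →* (K ≃ₗᵢ[ℝ] K))
    (W₁ : GroupLieAlgebra 𝓘(ℝ, E) G × G) (N₂ : StandardSubspace K)
    (N : wedgeOrbit ε W₁ → StandardSubspace K) : Prop :=
  ∀ (g : G) (hg : ε g = 1),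
    (N ⟨wedgeAct ε g W₁, g, hg, rfl⟩).toClosedSubmodule = image (U g) N₂.toClosedSubmodule

/-- Modular covariance of a net `N` on the positive wedge space of `W₁`:
`Δ_{N(Wa)}^{-it} N(Wb) = N(λ_{Wa}(2πt).Wb)` for all `Wa`, `Wb` and real `t`. -/
def IsModularCovariant (ε : G →* ℤˣ) (W₁ : GroupLieAlgebra 𝓘(ℝ, E) G × G)
    (N : wedgeOrbit ε W₁ → StandardSubspace K) : Prop :=
  ∀ (Wa Wb : wedgeOrbit ε W₁) (t : ℝ),
    ∃ h : wedgeAct ε (wedgeFlow Wa.1 (2 * Real.pi * t)) Wb.1 ∈ wedgeOrbit ε W₁,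
      image (toReal (modularGroup (N Wa) (-t))) (N Wb).toClosedSubmodule =
        (N ⟨wedgeAct ε (wedgeFlow Wa.1 (2 * Real.pi * t)) Wb.1, h⟩).toClosedSubmodule

end Nets

/-- The derivative at `1` of a homomorphism of Lie groups, as a map of Lie algebras. -/
def lieMap {F H E G : Type*} [NormedAddCommGroup F] [NormedSpace ℝ F]
    [TopologicalSpace H] [ChartedSpace F H] [Group H]
    [NormedAddCommGroup E] [NormedSpace ℝ E]
    [TopologicalSpace G] [ChartedSpace E G] [Group G]
    (ι : H →* G) (x : GroupLieAlgebra 𝓘(ℝ, F) H) : GroupLieAlgebra 𝓘(ℝ, E) G :=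
  mfderiv 𝓘(ℝ, F) 𝓘(ℝ, E) ι 1 x

end WedgeNet

end

/-!
# Modular covariance of nets of standard subspaces

**Unitary groups and their analytic generators.** Let `u` be a strongly continuous one-parameter
unitary group. The pairs `(F 0, F (-i))`, where `F` extends an orbit map of `u` to the strip
`-1 ≤ Im z ≤ 0`, form the graph `Gen u` of an operator `T`, the analytic generator of `u`. No
spectral theory is needed to see that `T` is positive and self-adjoint: for two such extensions the
function `⟪G (conj z - i), F z⟫` is holomorphic and invariant under real translations, hence
constant, and comparing its values at `0`, `-i/2` and `-i` gives symmetry (`Gen.symm`) and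
positivity (`Gen.nonneg`). Gaussian averages of vectors are entire, so that `T` is densely defined,
and by the three lines theorem `T` is closed; averaging the elements of the graph of `T*` shows
`T* ⊆ T` (`Gen.of_adjoint`).

**Existence.** If an antiunitary involution `J` commutes with `u`, then `J T J = T⁻¹`, so that `J T`
is an involution, and its fixed points form a standard subspace with Tomita operator `J T`
(`fixedStandard`). Applied to `J = U(τ₂)` and the one-parameter group of `h₂`, this yields the
Brunetti-Guido-Longo subspace. A standard subspace is recovered from its Tomita operator, so that
the modular objects determine it (`IsModularPair.standard_unique`).

**Uniqueness of the modular group.** If `J T = J' T'` are two polar decompositions of the same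
Tomita operator, then `T' = W T` with `W` unitary, and self-adjointness gives
`T'² = T'* T' = T* T = T²`. If `T` and `T'` are the generators of `u` and `v`, the function
`t ↦ ⟪v t (T² ξ'), u t ξ⟫` therefore extends to a bounded entire function of period `2i`, which is
constant by Liouville's theorem; hence `u = v` (`eq_of_gen_unitary`).

**Covariance.** The construction of the subspace is equivariant under even group elements, so that
elements fixing `W₂` stabilize `N₂`; this makes the net well defined. For `Wa = a.W₁` and
`Wb = b.W₁`, the modular group of `N Wa` is `U(a exp(s h₂) a⁻¹)` and the flow of `Wa` is
`a exp(s h₁) a⁻¹`. Since `exp(s h₁)` fixes `W₁`, it fixes `W₂`, whence it commutes with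
`exp(t h₂)`, and `exp(s h₂)⁻¹ exp(s h₁) = exp(s (h₁ - h₂))`. So covariance for `(Wa, Wb)` says that
`g exp(s (h₁ - h₂)) g⁻¹` stabilizes `N₂` for `g = b⁻¹ a` (`isModularCovariant_iff`).
-/

set_option linter.unusedSectionVars false

noncomputable section

namespace WedgeNet

/-! ### One-parameter groups of Lie groups -/

section LieGroups

variable {E G : Type*} [NormedAddCommGroup E] [NormedSpace ℝ E]
  [TopologicalSpace G] [ChartedSpace E G] [Group G] [LieGroup 𝓘(ℝ, E) ∞ G]
  {F H : Type*} [NormedAddCommGroup F] [NormedSpace ℝ F]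
  [TopologicalSpace H] [ChartedSpace F H] [Group H] [LieGroup 𝓘(ℝ, F) ∞ H]

theorem mdifferentiable_mul_left' (g : G) : MDifferentiable 𝓘(ℝ, E) 𝓘(ℝ, E) (fun y : G => g * y) :=
  (contMDiff_mul_left (I := 𝓘(ℝ, E)) (n := ∞)).mdifferentiable (by simp)

theorem mdifferentiable_mul_right' (g : G) : MDifferentiable 𝓘(ℝ, E) 𝓘(ℝ, E) (fun y : G => y * g) :=
  (contMDiff_mul_right (I := 𝓘(ℝ, E)) (n := ∞)).mdifferentiable (by simp)

theorem mdifferentiable_conj (g : G) :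
    MDifferentiable 𝓘(ℝ, E) 𝓘(ℝ, E) (fun y : G => g * y * g⁻¹) :=
  (mdifferentiable_mul_right' g⁻¹).comp (mdifferentiable_mul_left' g)

/-- The derivative of a map between manifolds, with the tangent spaces identified with the model
spaces, so that equal points need not be identified along a transport of tangent spaces. -/
def dmap (F E : Type*) [NormedAddCommGroup F] [NormedSpace ℝ F] [NormedAddCommGroup E]
    [NormedSpace ℝ E] {H G : Type*} [TopologicalSpace H] [ChartedSpace F H] [TopologicalSpace G]
    [ChartedSpace E G] (f : H → G) (p : H) : F →L[ℝ] E := mfderiv 𝓘(ℝ, F) 𝓘(ℝ, E) f p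

/-- The curve `γ` has velocity `v` at `t`. -/
def HasVelocity (γ : ℝ → G) (t : ℝ) (v : E) : Prop :=
  HasMFDerivAt 𝓘(ℝ, ℝ) 𝓘(ℝ, E) γ t ((1 : ℝ →L[ℝ] ℝ).smulRight v)

/-- The value at `g` of the left-invariant vector field of `x`, in the model space. -/
def leftField (x : GroupLieAlgebra 𝓘(ℝ, E) G) (g : G) : E := mulInvariantVectorField x g

theorem isExpCurve_iff {x : GroupLieAlgebra 𝓘(ℝ, E) G} {γ : ℝ → G} :
    IsExpCurve x γ ↔ γ 0 = 1 ∧ ∀ t, HasVelocity γ t (leftField x (γ t)) := Iff.rfl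

theorem HasVelocity.unique {γ : ℝ → G} {t : ℝ} {v w : E} (h : HasVelocity γ t v)
    (h' : HasVelocity γ t w) : v = w := by
  have h5 := congrArg (fun A : ℝ →L[ℝ] E => A 1) (hasMFDerivAt_unique h h')
  have h6 : ((1 : ℝ →L[ℝ] ℝ).smulRight v) 1 = ((1 : ℝ →L[ℝ] ℝ).smulRight w) 1 := h5
  simpa using h6

theorem HasVelocity.comp {γ : ℝ → H} {t : ℝ} {v : F} (h : HasVelocity γ t v) {f : H → G}
    (hf : MDifferentiableAt 𝓘(ℝ, F) 𝓘(ℝ, E) f (γ t)) :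
    HasVelocity (fun s => f (γ s)) t (dmap F E f (γ t) v) := by
  have h1 := hf.hasMFDerivAt.comp t h
  have h2 : ((dmap F E f (γ t) : F →L[ℝ] E).comp ((1 : ℝ →L[ℝ] ℝ).smulRight v)) =
    (1 : ℝ →L[ℝ] ℝ).smulRight (dmap F E f (γ t) v) := by ext; simp
  have h3 (A : ℝ →L[ℝ] E) (hA : (dmap F E f (γ t)).comp ((1 : ℝ →L[ℝ] ℝ).smulRight v) = A) :
      HasMFDerivAt 𝓘(ℝ, ℝ) 𝓘(ℝ, E) (fun s => f (γ s)) t A := hA ▸ h1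
  exact h3 _ h2

theorem HasVelocity.mul {γ η : ℝ → G} {t : ℝ} {v w : E} (hγ : HasVelocity γ t v)
    (hη : HasVelocity η t w) :
    HasVelocity (fun s => γ s * η s) t
      (dmap E E (fun z : G => z * η t) (γ t) v + dmap E E (fun z : G => γ t * z) (η t) w) := by
  have hm : MDifferentiableAt (𝓘(ℝ, E).prod 𝓘(ℝ, E)) 𝓘(ℝ, E) (fun p : G × G => p.1 * p.2)
      (γ t, η t) := (contMDiff_mul 𝓘(ℝ, E) ∞).mdifferentiable (by simp) _
  let D : E × E →L[ℝ] E :=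
    mfderiv (𝓘(ℝ, E).prod 𝓘(ℝ, E)) 𝓘(ℝ, E) (fun p : G × G => p.1 * p.2) (γ t, η t)
  have h1 := hm.hasMFDerivAt.comp t (hγ.prodMk hη)
  have hD : D (v, w) =
      dmap E E (fun z : G => z * η t) (γ t) v + dmap E E (fun z : G => γ t * z) (η t) w :=
    mfderiv_prod_eq_add_apply (v := (v, w)) hm
  have h2 : D.comp (((1 : ℝ →L[ℝ] ℝ).smulRight v).prod ((1 : ℝ →L[ℝ] ℝ).smulRight w)) =
    (1 : ℝ →L[ℝ] ℝ).smulRight (D (v, w)) := by ext; simp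
  rw [← hD]
  have h3 (A : ℝ →L[ℝ] E)
      (hA : D.comp (((1 : ℝ →L[ℝ] ℝ).smulRight v).prod ((1 : ℝ →L[ℝ] ℝ).smulRight w)) = A) :
      HasMFDerivAt 𝓘(ℝ, ℝ) 𝓘(ℝ, E) (fun s => γ s * η s) t A := hA ▸ h1
  exact h3 _ h2

theorem dmap_comp {E' G' : Type*} [NormedAddCommGroup E'] [NormedSpace ℝ E'] [TopologicalSpace G']
    [ChartedSpace E' G'] {f : G → G'} {g : H → G} {p : H}
    (hf : MDifferentiableAt 𝓘(ℝ, E) 𝓘(ℝ, E') f (g p))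
    (hg : MDifferentiableAt 𝓘(ℝ, F) 𝓘(ℝ, E) g p) :
    dmap F E' (fun x => f (g x)) p = (dmap E E' f (g p)).comp (dmap F E g p) :=
  mfderiv_comp (I' := 𝓘(ℝ, E)) p hf hg

theorem leftField_one (x : GroupLieAlgebra 𝓘(ℝ, E) G) : leftField x 1 = x := by
  have h : (fun y : G => 1 * y) = id := by ext y; simp
  have h1 : leftField x 1 = dmap E E (fun y : G => 1 * y) 1 x := rfl
  rw [h1, h]
  have : (dmap E E (id : G → G) 1 : E →L[ℝ] E) = ContinuousLinearMap.id ℝ E :=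
    mfderiv_id (I := 𝓘(ℝ, E))
  rw [this]
  rfl

/-- A smooth homomorphism relates the left-invariant vector fields of `x` and of its image under
the derivative of the homomorphism at `1`. -/
theorem dmap_hom_leftField (φ : H →* G)
    (hφ : MDifferentiable 𝓘(ℝ, F) 𝓘(ℝ, E) φ) (g : H) (x : GroupLieAlgebra 𝓘(ℝ, F) H) :
    dmap F E φ g (leftField x g) = leftField (lieMap φ x) (φ g) := by
  have h1 : (fun y : H => φ (g * y)) = (fun y : H => φ g * φ y) := by
    ext y; simp
  have h2 := dmap_comp (hφ (g * 1)) (mdifferentiable_mul_left' g 1)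
  rw [h1, dmap_comp (mdifferentiable_mul_left' (φ g) (φ 1)) (hφ 1), map_one, mul_one] at h2
  exact (congrArg (fun A : F →L[ℝ] E => A x) h2).symm

theorem dmap_mul_left_leftField (g h : G) (x : GroupLieAlgebra 𝓘(ℝ, E) G) :
    dmap E E (fun y : G => g * y) h (leftField x h) = leftField x (g * h) := by
  have h1 : (fun y : G => g * h * y) = fun y : G => g * (h * y) := by
    ext y; simp [mul_assoc]
  have h2 := dmap_comp (E := E) (mdifferentiable_mul_left' g (h * 1))
    (mdifferentiable_mul_left' h 1)
  rw [← h1, mul_one] at h2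
  exact (congrArg (fun A : E →L[ℝ] E => A x) h2).symm

theorem IsMIntegralCurveOn.mul_left {γ : ℝ → G} {x : GroupLieAlgebra 𝓘(ℝ, E) G} {s : Set ℝ}
    (hs : IsOpen s)
    (hγ : IsMIntegralCurveOn (I := 𝓘(ℝ, E)) γ (mulInvariantVectorField x) s) (g : G) :
    IsMIntegralCurveOn (I := 𝓘(ℝ, E)) (fun t => g * γ t) (mulInvariantVectorField x) s := by
  intro t ht
  have h0 : HasVelocity γ t (leftField x (γ t)) := (hγ t ht).hasMFDerivAt (hs.mem_nhds ht)
  have h1 := HasVelocity.comp h0 (mdifferentiable_mul_left' g (γ t))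
  rw [dmap_mul_left_leftField] at h1
  exact h1.hasMFDerivWithinAt

theorem IsMIntegralCurve.mul_left {γ : ℝ → G} {x : GroupLieAlgebra 𝓘(ℝ, E) G}
    (hγ : IsMIntegralCurve (I := 𝓘(ℝ, E)) γ (mulInvariantVectorField x)) (g : G) :
    IsMIntegralCurve (I := 𝓘(ℝ, E)) (fun t => g * γ t) (mulInvariantVectorField x) := by
  rw [isMIntegralCurve_iff_isMIntegralCurveOn] at hγ ⊢
  exact IsMIntegralCurveOn.mul_left isOpen_univ hγ g

theorem IsExpCurve.hom {γ : ℝ → H} {x : GroupLieAlgebra 𝓘(ℝ, F) H} (hγ : IsExpCurve x γ)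
    (φ : H →* G) (hφ : MDifferentiable 𝓘(ℝ, F) 𝓘(ℝ, E) φ) :
    IsExpCurve (E := E) (lieMap φ x) (fun t => φ (γ t)) := by
  refine isExpCurve_iff.2 ⟨by simp [hγ.1], fun t => ?_⟩
  rw [← dmap_hom_leftField φ hφ]
  exact HasVelocity.comp ((isExpCurve_iff.1 hγ).2 t) (hφ (γ t))

theorem contMDiff_mulInvariantVectorField_one (x : GroupLieAlgebra 𝓘(ℝ, E) G) :
    ContMDiff 𝓘(ℝ, E) 𝓘(ℝ, E).tangent 1
      (fun g : G => (⟨g, mulInvariantVectorField x g⟩ : TangentBundle 𝓘(ℝ, E) G)) := by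
  have : LieGroup 𝓘(ℝ, E) (minSmoothness ℝ 3) G :=
    LieGroup.of_le (n := ∞) (by simpa using ENat.LEInfty.out)
  exact (contMDiff_mulInvariantVectorField x).of_le (by simp)

theorem IsExpCurve.scale {γ : ℝ → G} {x : GroupLieAlgebra 𝓘(ℝ, E) G} (hγ : IsExpCurve x γ)
    (a : ℝ) : IsExpCurve (a • x) (fun t => γ (t * a)) := by
  refine ⟨by simp [hγ.1], ?_⟩
  rw [mulInvariantVectorField_smul]
  exact hγ.2.comp_mul a

theorem IsExpCurve.mul {γ η : ℝ → G} {x y : GroupLieAlgebra 𝓘(ℝ, E) G}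
    (hγ : IsExpCurve x γ) (hη : IsExpCurve y η) (hc : ∀ s t, γ s * η t = η t * γ s) :
    IsExpCurve (x + y) (fun t => γ t * η t) := by
  rw [isExpCurve_iff] at hγ hη ⊢
  refine ⟨by simp [hγ.1, hη.1], fun t => ?_⟩
  have h := HasVelocity.mul (hγ.2 t) (hη.2 t)
  -- `γ` and `η` commute, so the velocity of `s ↦ γ s * η t` can be computed by left translation
  have h1 : dmap E E (fun z : G => z * η t) (γ t) (leftField x (γ t)) =
      leftField x (γ t * η t) := by
    have h2 := HasVelocity.comp (hγ.2 t) (mdifferentiable_mul_right' (η t) (γ t))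
    have h3 := HasVelocity.comp (hγ.2 t) (mdifferentiable_mul_left' (η t) (γ t))
    rw [dmap_mul_left_leftField, ← hc t t] at h3
    simp_rw [← fun s => hc s t] at h3
    exact h2.unique h3
  rw [h1, dmap_mul_left_leftField] at h
  have h4 : leftField (x + y) (γ t * η t) = leftField x (γ t * η t) + leftField y (γ t * η t) :=
    congrFun (mulInvariantVectorField_add x y) (γ t * η t)
  rwa [h4]

/-- The velocity of a one-parameter group is determined by the curve. -/
theorem IsExpCurve.eq_of_same {γ : ℝ → G} {x y : GroupLieAlgebra 𝓘(ℝ, E) G}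
    (hx : IsExpCurve x γ) (hy : IsExpCurve y γ) : x = y := by
  have h := ((isExpCurve_iff.1 hx).2 0).unique ((isExpCurve_iff.1 hy).2 0)
  rwa [hx.1, leftField_one, leftField_one] at h

variable [T2Space G] [T2Space H]

theorem IsExpCurve.unique {γ η : ℝ → G} {x : GroupLieAlgebra 𝓘(ℝ, E) G} (hγ : IsExpCurve x γ)
    (hη : IsExpCurve x η) : γ = η := by
  have : IsManifold 𝓘(ℝ, E) 1 G := IsManifold.of_le (n := ∞) (by simp)
  exact isMIntegralCurve_Ioo_eq_of_contMDiff_boundaryless (t₀ := 0)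
    (contMDiff_mulInvariantVectorField_one x) hγ.2 hη.2 (hγ.1.trans hη.1.symm)

theorem IsExpCurve.map_add {γ : ℝ → G} {x : GroupLieAlgebra 𝓘(ℝ, E) G} (hγ : IsExpCurve x γ)
    (s t : ℝ) : γ (s + t) = γ s * γ t := by
  have : IsManifold 𝓘(ℝ, E) 1 G := IsManifold.of_le (n := ∞) (by simp)
  have := isMIntegralCurve_Ioo_eq_of_contMDiff_boundaryless (t₀ := 0)
    (contMDiff_mulInvariantVectorField_one x) (hγ.2.comp_add s)
    (IsMIntegralCurve.mul_left hγ.2 (γ s))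
    (by simp [hγ.1])
  have h := congrFun this t
  simpa [add_comm] using h

/-- Left-invariant vector fields are complete: left translates of a local integral curve through
`1` are integral curves, so all local integral curves live for a uniform time. -/
theorem exists_isExpCurve [CompleteSpace E] (x : GroupLieAlgebra 𝓘(ℝ, E) G) :
    ∃ γ : ℝ → G, IsExpCurve x γ := by
  have : IsManifold 𝓘(ℝ, E) 1 G := IsManifold.of_le (n := ∞) (by simp)
  have hv := contMDiff_mulInvariantVectorField_one x
  obtain ⟨γ, h0, h1⟩ := exists_isMIntegralCurveAt_of_contMDiffAt_boundaryless (t₀ := 0)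
    (hv.contMDiffAt (x := (1 : G)))
  obtain ⟨ε, hε, h2⟩ := isMIntegralCurveAt_iff'.1 h1
  obtain ⟨η, h3, h4⟩ := exists_isMIntegralCurve_of_isMIntegralCurveOn hv hε (fun g => by
    refine ⟨fun t => g * γ t, by simp [h0], ?_⟩
    have := IsMIntegralCurveOn.mul_left Metric.isOpen_ball h2 g
    rwa [Real.ball_eq_Ioo, zero_sub, zero_add] at this) 1
  exact ⟨η, h3, h4⟩

theorem IsExpCurve.lieExp_eq {γ : ℝ → G} {x : GroupLieAlgebra 𝓘(ℝ, E) G} (hγ : IsExpCurve x γ) :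
    lieExp x = γ 1 := by
  have h : ∃ γ : ℝ → G, IsExpCurve x γ := ⟨γ, hγ⟩
  rw [lieExp, dif_pos h, h.choose_spec.unique hγ]

theorem IsExpCurve.lieExp_smul_eq {γ : ℝ → G} {x : GroupLieAlgebra 𝓘(ℝ, E) G}
    (hγ : IsExpCurve x γ) (t : ℝ) : lieExp (t • x) = γ t := by
  rw [(hγ.scale t).lieExp_eq, one_mul]

variable [CompleteSpace E] [CompleteSpace F]

theorem isExpCurve_lieExp (x : GroupLieAlgebra 𝓘(ℝ, E) G) :
    IsExpCurve x (fun t : ℝ => lieExp (t • x)) := by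
  obtain ⟨γ, hγ⟩ := exists_isExpCurve x
  rwa [show (fun t : ℝ => lieExp (t • x)) = γ from funext hγ.lieExp_smul_eq]

theorem lieExp_add_smul (x : GroupLieAlgebra 𝓘(ℝ, E) G) (s t : ℝ) :
    lieExp ((s + t) • x) = lieExp (s • x) * lieExp (t • x) :=
  (isExpCurve_lieExp x).map_add s t

theorem lieExp_zero_smul (x : GroupLieAlgebra 𝓘(ℝ, E) G) : lieExp ((0 : ℝ) • x) = 1 :=
  (isExpCurve_lieExp x).1

theorem lieExp_neg_smul (x : GroupLieAlgebra 𝓘(ℝ, E) G) (t : ℝ) :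
    lieExp ((-t) • x) = (lieExp (t • x))⁻¹ := by
  rw [eq_inv_iff_mul_eq_one, ← lieExp_add_smul, neg_add_cancel, lieExp_zero_smul]

theorem continuous_lieExp_smul (x : GroupLieAlgebra 𝓘(ℝ, E) G) :
    Continuous fun t : ℝ => lieExp (t • x) := (isExpCurve_lieExp x).2.continuous

theorem lieExp_lieMap (φ : H →* G) (hφ : MDifferentiable 𝓘(ℝ, F) 𝓘(ℝ, E) φ)
    (x : GroupLieAlgebra 𝓘(ℝ, F) H) (t : ℝ) :
    lieExp (E := E) (t • lieMap φ x) = φ (lieExp (t • x)) :=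
  ((isExpCurve_lieExp x).hom φ hφ).lieExp_smul_eq t

theorem lieExp_Ad (g : G) (x : GroupLieAlgebra 𝓘(ℝ, E) G) (t : ℝ) :
    lieExp (t • Ad g x) = g * lieExp (t • x) * g⁻¹ :=
  lieExp_lieMap (MulAut.conj g).toMonoidHom (mdifferentiable_conj g) x t

/-- The exponentials of multiples of commuting elements multiply. -/
theorem lieExp_smul_sub {x y : GroupLieAlgebra 𝓘(ℝ, E) G}
    (hc : ∀ s t : ℝ, Commute (lieExp (s • x)) (lieExp (t • y))) (t : ℝ) :
    lieExp (t • (x - y)) = lieExp (t • x) * lieExp ((-t) • y) := by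
  have h := ((isExpCurve_lieExp x).mul ((isExpCurve_lieExp y).scale (-1))
    (fun s t => hc s _)).lieExp_smul_eq t
  rw [neg_one_smul, ← sub_eq_add_neg] at h
  simpa using h

theorem Ad_eq_dmap (g : G) (x : GroupLieAlgebra 𝓘(ℝ, E) G) :
    Ad g x = dmap E E (fun y : G => g * y * g⁻¹) 1 x := rfl

theorem Ad_mul (g h : G) (x : GroupLieAlgebra 𝓘(ℝ, E) G) : Ad (g * h) x = Ad g (Ad h x) := by
  have h1 : (fun y : G => g * h * y * (g * h)⁻¹) = fun y : G => g * (h * y * h⁻¹) * g⁻¹ := by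
    ext y; simp [mul_assoc]
  have h2 := dmap_comp (E := E) (G := G) (g := fun y : G => h * y * h⁻¹)
    (mdifferentiable_conj g (h * 1 * h⁻¹)) (mdifferentiable_conj h 1)
  rw [← h1, mul_one, mul_inv_cancel] at h2
  exact congrArg (fun A : E →L[ℝ] E => A x) h2

theorem Ad_one (x : GroupLieAlgebra 𝓘(ℝ, E) G) : Ad (1 : G) x = x := by
  have h : (fun y : G => 1 * y * 1⁻¹) = fun y : G => 1 * y := by ext y; simp
  rw [Ad_eq_dmap, h]
  exact leftField_one x

theorem Ad_smul (g : G) (c : ℝ) (x : GroupLieAlgebra 𝓘(ℝ, E) G) :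
    Ad g (c • x) = c • Ad g x :=
  (dmap E E (fun y : G => g * y * g⁻¹) 1).map_smul c x

theorem Ad_eq_of_conj_lieExp {g : G} {x y : GroupLieAlgebra 𝓘(ℝ, E) G}
    (h : ∀ t : ℝ, g * lieExp (t • x) * g⁻¹ = lieExp (t • y)) : Ad g x = y := by
  have h1 : IsExpCurve (Ad g x) _ := isExpCurve_lieExp (Ad g x)
  simp_rw [lieExp_Ad, h] at h1
  exact h1.eq_of_same (isExpCurve_lieExp y)

end LieGroups

/-! ### Holomorphic functions on horizontal strips -/

section Strips

open Complex Set Filter Topology Interval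

variable {X : Type*} [NormedAddCommGroup X] [NormedSpace ℂ X] [CompleteSpace X]

/-- A horizontal line is removable for continuous functions: by Cauchy's theorem on the two halves
of a rectangle, integrals along rectangles crossing the line vanish, and Morera's theorem
applies. -/
theorem differentiableOn_of_off_line {U : Set ℂ} (hU : IsOpen U) (c : ℝ) {f : ℂ → X}
    (hc : ContinuousOn f U) (hd : DifferentiableOn ℂ f (U \ {z | z.im = c})) :
    DifferentiableOn ℂ f U := by
  refine (isConservativeOn_and_continuousOn_iff_isDifferentiableOn hU).1 ⟨?_, hc⟩
  intro z w hzw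
  rw [← add_eq_zero_iff_eq_neg, wedgeIntegral_add_wedgeIntegral_eq]
  have hrect : ∀ a b : ℝ, [[a, b]] ⊆ [[z.im, w.im]] → c ∉ Ioo (min a b) (max a b) →
      (∫ x : ℝ in z.re..w.re, f (x + a * I)) - (∫ x : ℝ in z.re..w.re, f (x + b * I)) +
        I • (∫ y : ℝ in a..b, f (w.re + y * I)) -
        I • (∫ y : ℝ in a..b, f (z.re + y * I)) = 0 := by
    intro a b hab hcab
    have h := integral_boundary_rect_eq_zero_of_continuousOn_of_differentiableOn f
      (⟨z.re, a⟩ : ℂ) ⟨w.re, b⟩ ?_ ?_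
    · exact h
    · exact hc.mono fun x hx => hzw ⟨hx.1, hab hx.2⟩
    · refine hd.mono fun x hx =>
        ⟨hzw ⟨Ioo_subset_Icc_self hx.1, hab (Ioo_subset_Icc_self hx.2)⟩, ?_⟩
      intro hxc
      have hxc' : x.im = c := hxc
      exact hcab (hxc' ▸ hx.2)
  by_cases hcc : c ∈ Ioo (min z.im w.im) (max z.im w.im)
  · have hcI : c ∈ [[z.im, w.im]] := Ioo_subset_Icc_self hcc
    have h1 := hrect z.im c (uIcc_subset_uIcc left_mem_uIcc hcI) (by
      rintro ⟨h1, h2⟩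
      rcases le_total z.im c with h | h <;> simp [h] at h1 h2)
    have h2 := hrect c w.im (uIcc_subset_uIcc hcI right_mem_uIcc) (by
      rintro ⟨h1, h2⟩
      rcases le_total w.im c with h | h <;> simp [h] at h1 h2)
    have hint : ∀ r ∈ [[z.re, w.re]], ∀ a b : ℝ, [[a, b]] ⊆ [[z.im, w.im]] →
        IntervalIntegrable (fun y : ℝ => f (r + y * I)) MeasureTheory.volume a b := by
      intro r hr a b hab
      refine ContinuousOn.intervalIntegrable ?_
      refine hc.comp (by fun_prop) fun y hy => hzw ⟨?_, ?_⟩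
      · simpa using hr
      · simpa using hab hy
    have hs : ∀ r ∈ [[z.re, w.re]], (∫ y : ℝ in z.im..w.im, f (r + y * I)) =
        (∫ y : ℝ in z.im..c, f (r + y * I)) + ∫ y : ℝ in c..w.im, f (r + y * I) := fun r hr =>
      (intervalIntegral.integral_add_adjacent_intervals
        (hint r hr _ _ (uIcc_subset_uIcc left_mem_uIcc hcI))
        (hint r hr _ _ (uIcc_subset_uIcc hcI right_mem_uIcc))).symm
    rw [hs _ left_mem_uIcc, hs _ right_mem_uIcc, smul_add, smul_add]
    rw [← add_zero (0 : X)]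
    nth_rewrite 1 [← h1]
    rw [← h2]
    abel
  · exact hrect z.im w.im subset_rfl hcc

/-- The closed strip `-1 ≤ Im z ≤ 0`. -/
def strip : Set ℂ := {z | -1 ≤ z.im ∧ z.im ≤ 0}

/-- The open strip `-1 < Im z < 0`. -/
def openStrip : Set ℂ := {z | -1 < z.im ∧ z.im < 0}

theorem isOpen_openStrip : IsOpen openStrip :=
  (isOpen_lt continuous_const continuous_im).inter (isOpen_lt continuous_im continuous_const)

theorem isClosed_strip : IsClosed strip :=
  (isClosed_le continuous_const continuous_im).inter (isClosed_le continuous_im continuous_const)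

theorem openStrip_eq : openStrip = im ⁻¹' Ioo (-1) 0 := rfl

theorem closure_openStrip : closure openStrip = strip := by
  rw [openStrip_eq, Complex.closure_preimage_im, closure_Ioo (by norm_num)]
  rfl

/-- A function which is continuous on the closed strip and holomorphic on the open strip. -/
structure HolStrip (F : ℂ → X) : Prop where
  cont : ContinuousOn F strip
  diff : DifferentiableOn ℂ F openStrip

theorem ofReal_mem_strip (t : ℝ) : (t : ℂ) ∈ strip := by simp [strip]

/-- A family `k n` of uniformly bounded functions on the strip such that the values of `k n` on the
lower edge are those of `k (n - 1)` on the upper edge glues to a bounded entire function, so that it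
is constant by Liouville's theorem. -/
theorem eq_of_glue (k : ℤ → ℂ → X) (hk : ∀ n, HolStrip (k n)) {C : ℝ}
    (hC : ∀ n, ∀ z ∈ strip, ‖k n z‖ ≤ C) (hg : ∀ n, ∀ t : ℝ, k n (t - I) = k (n - 1) t) (t : ℝ) :
    k 0 t = k 0 0 := by
  -- the glued function is `z ↦ k n (z - n i)` on the strip `n - 1 < Im z ≤ n`
  set K : ℂ → X := fun z => k ⌈z.im⌉ (z - ⌈z.im⌉ * I) with hK
  have hKm : ∀ (m : ℤ) (z : ℂ), (m : ℝ) - 1 ≤ z.im → z.im ≤ m → K z = k m (z - m * I) := by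
    intro m z h1 h2
    rcases h1.eq_or_lt with h1 | h1
    · have hce : ⌈z.im⌉ = m - 1 := by
        rw [← h1]; exact_mod_cast Int.ceil_intCast (R := ℝ) (m - 1)
      have h3 : z - m * I = (z.re : ℂ) - I := by
        apply Complex.ext <;> simp [← h1]
      have h4 : z - ((m - 1 : ℤ) : ℂ) * I = (z.re : ℂ) := by
        apply Complex.ext <;> simp [← h1]
      simp only [hK]
      rw [hce, h3, h4, hg]
    · have hce : ⌈z.im⌉ = m := by
        rw [Int.ceil_eq_iff]; exact ⟨h1, h2⟩
      simp only [hK, hce]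
  have hcont : ∀ m : ℤ, ContinuousOn K {z | (m : ℝ) - 1 ≤ z.im ∧ z.im ≤ m} := by
    intro m
    refine ContinuousOn.congr (f := fun z => k m (z - m * I)) ?_ fun z hz => hKm m z hz.1 hz.2
    refine (hk m).cont.comp (by fun_prop) fun z hz => ⟨?_, ?_⟩
    · have := hz.1; simp; linarith
    · have := hz.2; simp; linarith
  have hdiff : ∀ m : ℤ, ∀ z : ℂ, (m : ℝ) - 1 < z.im → z.im < m → DifferentiableAt ℂ K z := by
    intro m z h1 h2
    have ho : IsOpen {z : ℂ | (m : ℝ) - 1 < z.im ∧ z.im < m} :=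
      (isOpen_lt continuous_const continuous_im).inter (isOpen_lt continuous_im continuous_const)
    have he : K =ᶠ[𝓝 z] fun z => k m (z - m * I) := by
      filter_upwards [ho.mem_nhds ⟨h1, h2⟩] with y hy using hKm m y hy.1.le hy.2.le
    refine DifferentiableAt.congr_of_eventuallyEq ?_ he
    have hz : z - m * I ∈ openStrip := ⟨by simp; linarith, by simp; linarith⟩
    exact DifferentiableAt.comp z ((hk m).diff.differentiableAt (isOpen_openStrip.mem_nhds hz))
      (by fun_prop)
  have hKd : Differentiable ℂ K := by
    intro z
    set m := ⌈z.im⌉ with hm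
    set U : Set ℂ := {z | (m : ℝ) - 1 < z.im ∧ z.im < m + 1} with hUdef
    have hU : IsOpen U :=
      (isOpen_lt continuous_const continuous_im).inter (isOpen_lt continuous_im continuous_const)
    have hzU : z ∈ U := by
      have h1 := Int.le_ceil z.im
      have h2 := Int.ceil_lt_add_one z.im
      exact ⟨by linarith, by linarith⟩
    have hcU : ContinuousOn K U := by
      have h := (hcont m).union_of_isClosed (hcont (m + 1))
        ((isClosed_le continuous_const continuous_im).inter
          (isClosed_le continuous_im continuous_const))
        ((isClosed_le continuous_const continuous_im).inter
          (isClosed_le continuous_im continuous_const))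
      refine h.mono fun y hy => ?_
      rcases le_total y.im m with h | h
      · exact Or.inl ⟨hy.1.le, h⟩
      · exact Or.inr ⟨by push_cast; linarith, by push_cast; exact hy.2.le⟩
    have hdU : DifferentiableOn ℂ K (U \ {z | z.im = m}) := by
      rintro y ⟨hy, hne⟩
      refine DifferentiableAt.differentiableWithinAt ?_
      rcases lt_or_gt_of_ne (show y.im ≠ m from hne) with h | h
      · exact hdiff m y hy.1 h
      · exact hdiff (m + 1) y (by push_cast; linarith) (by push_cast; exact hy.2)
    exact (differentiableOn_of_off_line hU m hcU hdU).differentiableAt (hU.mem_nhds hzU)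
  have hb : Bornology.IsBounded (range K) := by
    rw [isBounded_iff_forall_norm_le]
    refine ⟨C, ?_⟩
    rintro _ ⟨z, rfl⟩
    have h1 := Int.le_ceil z.im
    have h2 := Int.ceil_lt_add_one z.im
    exact hC _ _ ⟨by simp; linarith, by simp; linarith⟩
  have h := hKd.apply_eq_apply_of_bounded hb t 0
  simpa [hK] using h

/-- A function on the strip is determined by its values on the upper edge: extended by zero, a
function that vanishes there stays holomorphic. -/
theorem HolStrip.eq_zero {F : ℂ → X} (hF : HolStrip F) (h0 : ∀ t : ℝ, F t = 0) {z : ℂ}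
    (hz : z ∈ strip) : F z = 0 := by
  set G : ℂ → X := fun z => if z.im ≤ 0 then F z else 0 with hG
  set U : Set ℂ := {z | -1 < z.im} with hUdef
  have hU : IsOpen U := isOpen_lt continuous_const continuous_im
  have hGz : ∀ z : ℂ, 0 ≤ z.im → G z = 0 := by
    intro z hz
    rcases hz.eq_or_lt with h | h
    · have : z = (z.re : ℂ) := by apply Complex.ext <;> simp [← h]
      simp only [hG, ← h, le_refl, if_true]
      rw [this, h0]
    · simp [hG, not_le.2 h]
  have hGF : ∀ z : ℂ, z.im ≤ 0 → G z = F z := fun z hz => by simp [hG, hz]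
  have hcU : ContinuousOn G U := by
    have h1 : ContinuousOn G strip := hF.cont.congr fun z hz => hGF z hz.2
    have h2 : ContinuousOn G {z | 0 ≤ z.im} := continuousOn_const.congr fun z hz => hGz z hz
    refine (h1.union_of_isClosed h2 isClosed_strip
      (isClosed_le continuous_const continuous_im)).mono fun y hy => ?_
    rcases le_total y.im 0 with h | h
    · exact Or.inl ⟨le_of_lt hy, h⟩
    · exact Or.inr h
  have hdU : DifferentiableOn ℂ G (U \ {z | z.im = 0}) := by
    rintro y ⟨hy, hne⟩
    refine DifferentiableAt.differentiableWithinAt ?_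
    rcases lt_or_gt_of_ne (show y.im ≠ 0 from hne) with h | h
    · have hy' : y ∈ openStrip := ⟨hy, h⟩
      refine (hF.diff.differentiableAt (isOpen_openStrip.mem_nhds hy')).congr_of_eventuallyEq ?_
      filter_upwards [isOpen_openStrip.mem_nhds hy'] with x hx using hGF x hx.2.le
    · refine (differentiableAt_const (0 : X)).congr_of_eventuallyEq ?_
      filter_upwards [(isOpen_lt continuous_const continuous_im).mem_nhds h] with x hx
        using hGz x (le_of_lt hx)
  have han : AnalyticOnNhd ℂ G U := (differentiableOn_of_off_line hU 0 hcU hdU).analyticOnNhd hU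
  have hpre : IsPreconnected U := (convex_halfSpace_im_gt (-1)).isPreconnected
  have hzero : EqOn G 0 U := by
    refine han.eqOn_zero_of_preconnected_of_eventuallyEq_zero hpre (z₀ := I)
      (by simp [hUdef]) ?_
    filter_upwards [(isOpen_lt continuous_const continuous_im).mem_nhds
      (show (0 : ℝ) < I.im by simp)] with x hx using hGz x (le_of_lt hx)
  have hF0 : EqOn F 0 openStrip := fun y hy => by rw [← hGF y hy.2.le]; exact hzero hy.1
  have := hF0.of_subset_closure hF.cont continuousOn_const
    (fun x hx => ⟨hx.1.le, hx.2.le⟩) closure_openStrip.ge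
  exact this hz

theorem HolStrip.sub {F G : ℂ → X} (hF : HolStrip F) (hG : HolStrip G) :
    HolStrip fun z => F z - G z := ⟨hF.cont.sub hG.cont, hF.diff.sub hG.diff⟩

theorem HolStrip.add {F G : ℂ → X} (hF : HolStrip F) (hG : HolStrip G) :
    HolStrip fun z => F z + G z := ⟨hF.cont.add hG.cont, hF.diff.add hG.diff⟩

theorem HolStrip.clm {Y : Type*} [NormedAddCommGroup Y] [NormedSpace ℂ Y] {F : ℂ → X}
    (hF : HolStrip F) (A : X →L[ℂ] Y) : HolStrip fun z => A (F z) :=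
  ⟨A.continuous.comp_continuousOn hF.cont, A.differentiable.comp_differentiableOn hF.diff⟩

theorem HolStrip.comp_add_ofReal {F : ℂ → X} (hF : HolStrip F) (t : ℝ) :
    HolStrip fun z => F (z + t) :=
  ⟨hF.cont.comp (by fun_prop) fun z hz => ⟨by simpa using hz.1, by simpa using hz.2⟩,
    hF.diff.comp (by fun_prop) fun z hz => ⟨by simpa using hz.1, by simpa using hz.2⟩⟩

theorem HolStrip.eqOn {F G : ℂ → X} (hF : HolStrip F) (hG : HolStrip G)
    (h : ∀ t : ℝ, F t = G t) {z : ℂ} (hz : z ∈ strip) : F z = G z :=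
  sub_eq_zero.1 ((hF.sub hG).eq_zero (fun t => sub_eq_zero.2 (h t)) hz)

theorem HolStrip.norm_le {F : ℂ → X} (hF : HolStrip F) {B C : ℝ} (hB : ∀ z ∈ strip, ‖F z‖ ≤ B)
    (h0 : ∀ t : ℝ, ‖F t‖ ≤ C) (h1 : ∀ t : ℝ, ‖F (t - I)‖ ≤ C) {z : ℂ} (hz : z ∈ strip) :
    ‖F z‖ ≤ C := by
  refine PhragmenLindelof.horizontal_strip (a := -1) (b := 0) (f := F) ⟨hF.diff, ?_⟩
    ⟨0, by simp; positivity, 0, ?_⟩ ?_ ?_ hz.1 hz.2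
  · rw [← openStrip_eq, closure_openStrip]; exact hF.cont
  · simp only [zero_mul, Real.exp_zero]
    refine Asymptotics.IsBigO.of_bound B ?_
    refine Filter.mem_inf_of_right ?_
    intro z hz
    simpa using hB z ⟨hz.1.le, hz.2.le⟩
  · intro w hw
    have : w = (w.re : ℂ) - I := by apply Complex.ext <;> simp [hw]
    rw [this]; exact h1 _
  · intro w hw
    have : w = (w.re : ℂ) := by apply Complex.ext <;> simp [hw]
    rw [this]; exact h0 _

end Strips

/-! ### Gaussian regularization of one-parameter unitary groups -/

section Gauss

open Complex Set Filter Topology MeasureTheory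

variable {K : Type*} [NormedAddCommGroup K] [InnerProductSpace ℂ K] [CompleteSpace K]

/-- A strongly continuous one-parameter group of unitary operators. -/
structure IsUnitaryGroup (u : ℝ → K ≃ₗᵢ[ℂ] K) : Prop where
  add : ∀ s t : ℝ, ∀ ξ : K, u (s + t) ξ = u s (u t ξ)
  continuous : ∀ ξ : K, Continuous fun t => u t ξ

namespace IsUnitaryGroup

variable {u : ℝ → K ≃ₗᵢ[ℂ] K} (hu : IsUnitaryGroup u)
include hu

theorem zero (ξ : K) : u 0 ξ = ξ :=
  (u 0).injective (by rw [← hu.add, add_zero])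

theorem apply_neg (t : ℝ) (ξ : K) : u t (u (-t) ξ) = ξ := by
  rw [← hu.add, add_neg_cancel, hu.zero]

theorem comm (s t : ℝ) (ξ : K) : u s (u t ξ) = u t (u s ξ) := by
  rw [← hu.add, ← hu.add, add_comm]

theorem inner_apply (t : ℝ) (ξ η : K) : inner ℂ (u t ξ) η = inner ℂ ξ (u (-t) η) := by
  rw [← (u t).inner_map_map ξ, hu.apply_neg]

theorem scale (c : ℝ) : IsUnitaryGroup fun t => u (c * t) :=
  ⟨fun s t ξ => by rw [mul_add, hu.add], fun ξ => (hu.continuous ξ).comp (by fun_prop)⟩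

end IsUnitaryGroup

/-- The Gaussian probability density, translated by the complex number `z`. -/
def gauss (z : ℂ) (s : ℝ) : ℂ := (√Real.pi : ℂ)⁻¹ * cexp (-(s - z) ^ 2)

theorem gauss_eq (z : ℂ) (s : ℝ) :
    gauss z s = (√Real.pi : ℂ)⁻¹ * cexp ((-1) * s ^ 2 + (2 * z) * s + (-z ^ 2)) := by
  rw [gauss]; ring_nf

theorem integrable_gauss (z : ℂ) : Integrable (gauss z) := by
  rw [show gauss z = _ from funext (gauss_eq z)]
  exact (integrable_cexp_quadratic' (by simp) _ _).const_mul _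

theorem continuous_gauss (z : ℂ) : Continuous (gauss z) := by
  unfold gauss; fun_prop

theorem gauss_zero (s : ℝ) : gauss 0 s = (((√Real.pi)⁻¹ * Real.exp (-1 * s ^ 2) : ℝ) : ℂ) := by
  simp [gauss]

theorem norm_gauss_zero (s : ℝ) : ‖gauss 0 s‖ = (√Real.pi)⁻¹ * Real.exp (-1 * s ^ 2) := by
  rw [gauss_zero, norm_real, Real.norm_of_nonneg (by positivity)]

theorem integral_norm_gauss_zero : ∫ s : ℝ, ‖gauss 0 s‖ = 1 := by
  simp_rw [norm_gauss_zero]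
  rw [integral_const_mul, integral_gaussian, div_one, inv_mul_cancel₀]
  exact (Real.sqrt_pos.2 Real.pi_pos).ne'

theorem integral_gauss_zero : ∫ s : ℝ, gauss 0 s = 1 := by
  have h := integral_norm_gauss_zero
  simp_rw [norm_gauss_zero] at h
  simp_rw [gauss_zero]
  rw [integral_complex_ofReal, h, ofReal_one]

variable {u : ℝ → K ≃ₗᵢ[ℂ] K} (hu : IsUnitaryGroup u)

include hu in
theorem integrable_gauss_smul (z : ℂ) (ξ : K) : Integrable fun s : ℝ => gauss z s • u s ξ :=
  (integrable_gauss z).smul_bdd ‖ξ‖ (hu.continuous ξ).aestronglyMeasurable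
    (Eventually.of_forall fun _ => (LinearIsometryEquiv.norm_map _ _).le)

/-- The orbit `z ↦ ∫ gauss(s - z) u(s) ξ ds` of a Gaussian average of `ξ`, which extends to an
entire function. -/
def gaussOrbit (u : ℝ → K ≃ₗᵢ[ℂ] K) (ξ : K) (z : ℂ) : K := ∫ s : ℝ, gauss z s • u s ξ

include hu in
theorem gaussOrbit_add (ξ : K) (z : ℂ) (t : ℝ) :
    gaussOrbit u ξ (z + t) = u t (gaussOrbit u ξ z) := by
  unfold gaussOrbit
  rw [← integral_add_right_eq_self _ t, ← LinearIsometryEquiv.coe_coe'' (u t),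
    ← ContinuousLinearMap.integral_comp_comm _ (integrable_gauss_smul hu z ξ)]
  congr 1
  ext s
  have h1 : gauss (z + t) (s + t) = gauss z s := by
    unfold gauss; push_cast; ring_nf
  rw [h1]
  simp [hu.add, hu.comm]

theorem exp_abs_le (a c d s : ℝ) :
    Real.exp (a * s ^ 2 + c * |s| + d) ≤
      Real.exp (a * s ^ 2 + c * s + d) + Real.exp (a * s ^ 2 + (-c) * s + d) := by
  rcases abs_cases s with ⟨h, _⟩ | ⟨h, _⟩ <;> rw [h]
  · exact le_add_of_nonneg_right (Real.exp_pos _).le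
  · rw [mul_neg, ← neg_mul]; exact le_add_of_nonneg_left (Real.exp_pos _).le

theorem integrable_rexp_quadratic (c d : ℝ) :
    Integrable fun s : ℝ => Real.exp (-1 * s ^ 2 + c * s + d) := by
  have h := (integrable_cexp_quadratic' (b := -1) (by simp) (c : ℂ) (d : ℂ)).norm
  refine h.congr (Eventually.of_forall fun s => ?_)
  simp only [Complex.norm_exp]
  congr 1
  have : (-1 * (s : ℂ) ^ 2 + c * s + d) = ((-1 * s ^ 2 + c * s + d : ℝ) : ℂ) := by push_cast; ring
  rw [this, ofReal_re]

include hu in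
theorem differentiable_gaussOrbit (ξ : K) : Differentiable ℂ (gaussOrbit u ξ) := by
  intro z₀
  set M : ℝ := ‖z₀‖ + 1 with hM
  have hM0 : 0 < M := by positivity
  -- for `‖z‖ ≤ M` the derivative is dominated by a multiple of `exp (-s² + (2M + 1) |s| + M² + M)`
  set B : ℝ → ℝ := fun s => (√Real.pi)⁻¹ * (2 *
    (Real.exp (-1 * s ^ 2 + (2 * M + 1) * s + (M ^ 2 + M))
    + Real.exp (-1 * s ^ 2 + (-(2 * M + 1)) * s + (M ^ 2 + M)))) * ‖ξ‖ with hB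
  refine (hasDerivAt_integral_of_dominated_loc_of_deriv_le (s := Metric.ball z₀ 1)
    (F' := fun z s => (gauss z s * (2 * (s - z))) • u s ξ) (bound := B)
    (Metric.ball_mem_nhds _ one_pos) ?_ (integrable_gauss_smul hu z₀ ξ) ?_ ?_ ?_
    ?_).2.differentiableAt
  · exact Eventually.of_forall fun z => (integrable_gauss_smul hu z ξ).aestronglyMeasurable
  · refine Continuous.aestronglyMeasurable ?_
    exact ((continuous_gauss z₀).mul (by fun_prop)).smul (hu.continuous ξ)
  · refine Eventually.of_forall fun s z hz => ?_
    have hzM : ‖z‖ ≤ M := by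
      have h1 : ‖z - z₀‖ < 1 := by simpa [dist_eq_norm] using hz
      have h2 := norm_le_norm_add_norm_sub' z z₀
      linarith
    rw [norm_smul, (u s).norm_map]
    refine mul_le_mul_of_nonneg_right ?_ (norm_nonneg _)
    rw [norm_mul, gauss, norm_mul, norm_inv, norm_real, Real.norm_of_nonneg (Real.sqrt_nonneg _),
      mul_assoc]
    refine mul_le_mul_of_nonneg_left ?_ (by positivity)
    have h3 : ‖cexp (-(s - z) ^ 2)‖ ≤ Real.exp (-1 * s ^ 2 + 2 * M * |s| + M ^ 2) := by
      rw [Complex.norm_exp]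
      refine Real.exp_le_exp.2 ?_
      have e : (-((s : ℂ) - z) ^ 2).re = -1 * s ^ 2 + 2 * (s * z.re) - z.re ^ 2 + z.im ^ 2 := by
        simp [sq]; ring
      rw [e]
      have h4 : s * z.re ≤ M * |s| := by
        calc s * z.re ≤ |s * z.re| := le_abs_self _
          _ = |z.re| * |s| := by rw [abs_mul, mul_comm]
          _ ≤ M * |s| := mul_le_mul_of_nonneg_right ((abs_re_le_norm z).trans hzM) (abs_nonneg _)
      have h5 : z.im ^ 2 ≤ M ^ 2 := sq_le_sq' (by
        have := abs_le.1 ((abs_im_le_norm z).trans hzM); linarith)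
        (abs_le.1 ((abs_im_le_norm z).trans hzM)).2
      nlinarith [sq_nonneg z.re]
    have h6 : ‖(2 * ((s : ℂ) - z))‖ ≤ 2 * Real.exp (|s| + M) := by
      rw [norm_mul, Complex.norm_ofNat]
      refine mul_le_mul_of_nonneg_left ?_ two_pos.le
      have h7 := norm_sub_le (s : ℂ) z
      rw [norm_real, Real.norm_eq_abs] at h7
      have := Real.add_one_le_exp (|s| + M)
      linarith
    calc ‖cexp (-(s - z) ^ 2)‖ * ‖(2 * ((s : ℂ) - z))‖
        ≤ Real.exp (-1 * s ^ 2 + 2 * M * |s| + M ^ 2) * (2 * Real.exp (|s| + M)) :=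
          mul_le_mul h3 h6 (norm_nonneg _) (Real.exp_pos _).le
      _ = 2 * Real.exp (-1 * s ^ 2 + (2 * M + 1) * |s| + (M ^ 2 + M)) := by
          rw [mul_left_comm, ← Real.exp_add]; ring_nf
      _ ≤ _ := mul_le_mul_of_nonneg_left (exp_abs_le _ _ _ s) two_pos.le
  · exact ((((integrable_rexp_quadratic _ _).add (integrable_rexp_quadratic _ _)).const_mul
      2).const_mul _).mul_const _
  · refine Eventually.of_forall fun s z _ => ?_
    have h1 : HasDerivAt (fun z => gauss z s) (gauss z s * (2 * (s - z))) z := by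
      unfold gauss
      have h2 : HasDerivAt (fun z : ℂ => -((s : ℂ) - z) ^ 2) (2 * (s - z)) z := by
        have := (((hasDerivAt_id z).const_sub (s : ℂ)).pow 2).neg
        convert! this using 1
        simp
      convert! (h2.cexp.const_mul ((√Real.pi : ℂ)⁻¹)) using 1
      ring
    exact h1.smul_const _

/-- The Gaussian average `ξ ↦ ∫ gauss(s) u(δ s) ξ ds` of a unitary group at scale `δ`. -/
def smoothing (u : ℝ → K ≃ₗᵢ[ℂ] K) (hu : IsUnitaryGroup u) (δ : ℝ) : K →L[ℂ] K :=
  LinearMap.mkContinuous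
    { toFun := fun ξ => gaussOrbit (fun t => u (δ * t)) ξ 0
      map_add' := fun ξ η => by
        simp only [gaussOrbit, map_add, smul_add]
        exact integral_add (integrable_gauss_smul (hu.scale δ) 0 ξ)
          (integrable_gauss_smul (hu.scale δ) 0 η)
      map_smul' := fun c ξ => by
        simp only [gaussOrbit, map_smul, RingHom.id_apply]
        rw [← integral_smul]
        exact integral_congr_ae (Eventually.of_forall fun s => smul_comm _ _ _) } 1 (by
    intro ξ
    refine (norm_integral_le_integral_norm _).trans ?_
    simp_rw [norm_smul, LinearIsometryEquiv.norm_map]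
    rw [integral_mul_const, integral_norm_gauss_zero])

theorem smoothing_apply (δ : ℝ) (ξ : K) :
    smoothing u hu δ ξ = ∫ s : ℝ, gauss 0 s • u (δ * s) ξ := rfl

theorem smoothing_comm (δ t : ℝ) (ξ : K) : smoothing u hu δ (u t ξ) = u t (smoothing u hu δ ξ) := by
  rw [smoothing_apply, smoothing_apply, ← LinearIsometryEquiv.coe_coe'' (u t),
    ← ContinuousLinearMap.integral_comp_comm _ (integrable_gauss_smul (hu.scale δ) 0 ξ)]
  congr 1
  ext s
  simp [hu.comm]

/-- Gaussian averages are symmetric operators, since the density is real and even. -/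
theorem inner_smoothing (δ : ℝ) (ξ η : K) :
    inner ℂ (smoothing u hu δ ξ) η = inner ℂ ξ (smoothing u hu δ η) := by
  have h1 : inner ℂ ξ (smoothing u hu δ η) = ∫ s : ℝ, gauss 0 s * inner ℂ ξ (u (δ * s) η) := by
    rw [smoothing_apply, ← integral_inner (integrable_gauss_smul (hu.scale δ) 0 η)]
    simp_rw [inner_smul_right]
  have h2 : inner ℂ η (smoothing u hu δ ξ) = ∫ s : ℝ, gauss 0 s * inner ℂ η (u (δ * s) ξ) := by
    rw [smoothing_apply, ← integral_inner (integrable_gauss_smul (hu.scale δ) 0 ξ)]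
    simp_rw [inner_smul_right]
  rw [← inner_conj_symm, h2, h1, ← integral_conj, ← integral_neg_eq_self]
  congr 1
  ext s
  rw [map_mul, inner_conj_symm, hu.inner_apply, gauss_zero, gauss_zero, conj_ofReal]
  simp

/-- Gaussian averages at scale `δ` converge strongly to the identity as `δ → 0`. -/
theorem tendsto_smoothing (ξ : K) :
    Tendsto (fun n : ℕ => smoothing u hu (1 / ((n : ℝ) + 1)) ξ) atTop (𝓝 ξ) := by
  have h : Tendsto (fun n : ℕ => smoothing u hu (1 / ((n : ℝ) + 1)) ξ) atTop
      (𝓝 (∫ s : ℝ, gauss 0 s • ξ)) := by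
    simp_rw [smoothing_apply]
    refine tendsto_integral_of_dominated_convergence (fun s => ‖gauss 0 s‖ * ‖ξ‖) ?_ ?_ ?_ ?_
    · exact fun n => (integrable_gauss_smul (hu.scale _) 0 ξ).aestronglyMeasurable
    · exact (integrable_gauss 0).norm.mul_const _
    · intro n
      refine Eventually.of_forall fun s => ?_
      rw [norm_smul, LinearIsometryEquiv.norm_map]
    · refine Eventually.of_forall fun s => Tendsto.const_smul ?_ _
      have h1 : Tendsto (fun n : ℕ => 1 / ((n : ℝ) + 1) * s) atTop (𝓝 (0 * s)) :=
        tendsto_one_div_add_atTop_nhds_zero_nat.mul_const s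
      have h2 := ((hu.continuous ξ).tendsto (0 * s)).comp h1
      rwa [zero_mul, hu.zero] at h2
  rwa [integral_smul_const, integral_gauss_zero, one_smul] at h

/-- Gaussian averages are entire vectors: their orbits extend to entire functions. -/
theorem exists_entire_orbit {δ : ℝ} (hδ : 0 < δ) (ξ : K) : ∃ F : ℂ → K, Differentiable ℂ F ∧
    (∀ z (t : ℝ), F (z + t) = u t (F z)) ∧ F 0 = smoothing u hu δ ξ := by
  refine ⟨fun z => gaussOrbit (fun t => u (δ * t)) ξ (z / δ),
    (differentiable_gaussOrbit (hu.scale δ) ξ).comp (by fun_prop), fun z t => ?_, ?_⟩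
  · have h := gaussOrbit_add (hu.scale δ) ξ (z / δ) (t / δ)
    rw [mul_div_cancel₀ t hδ.ne'] at h
    rw [← h]
    simp only [add_div, ofReal_div]
  · simp only [zero_div]; rfl

end Gauss

/-! ### The analytic generator of a one-parameter unitary group -/

section Generator

open Complex Set Filter Topology

variable {K : Type*} [NormedAddCommGroup K] [InnerProductSpace ℂ K] [CompleteSpace K]

/-- Conjugating a function on the strip by semilinear maps, with the reflection `z ↦ conj z - i`
that exchanges the two edges. -/
theorem HolStrip.semilinear {X Y : Type*} [NormedAddCommGroup X] [NormedSpace ℂ X]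
    [NormedAddCommGroup Y] [NormedSpace ℂ Y] {F : ℂ → X}
    (hF : HolStrip F) (A : X →L⋆[ℂ] Y) :
    HolStrip fun z => A (F ((starRingEnd ℂ) z - I)) := by
  refine ⟨A.continuous.comp_continuousOn (hF.cont.comp (by fun_prop) fun z hz => ?_),
    fun z hz => DifferentiableAt.differentiableWithinAt ?_⟩
  · exact ⟨by simpa using hz.2, by simpa [neg_le] using hz.1⟩
  · have hz' : (starRingEnd ℂ) z - I ∈ openStrip :=
      ⟨by simpa using hz.2, by simpa [neg_lt] using hz.1⟩
    have h1 : DifferentiableAt ℂ (fun w => F (w - I)) ((starRingEnd ℂ) z) :=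
      DifferentiableAt.comp _ (hF.diff.differentiableAt (isOpen_openStrip.mem_nhds hz'))
        (by fun_prop)
    exact DifferentiableAt.comp_semilinear₂ A ((starL ℂ : ℂ ≃L⋆[ℂ] ℂ) : ℂ →L⋆[ℂ] ℂ) h1

theorem HolStrip.inner {F G : ℂ → K} (hF : HolStrip F) (hG : HolStrip G) :
    HolStrip fun z => inner ℂ (G ((starRingEnd ℂ) z - I)) (F z) := by
  have h := hG.semilinear (innerSL ℂ)
  exact ⟨h.cont.clm_apply hF.cont, h.diff.clm_apply hF.diff⟩

/-- `F` extends the orbit map `t ↦ u t ξ` to the strip. -/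
structure IsOrbit (u : ℝ → K ≃ₗᵢ[ℂ] K) (ξ : K) (F : ℂ → K) : Prop where
  hol : HolStrip F
  eq : ∀ t : ℝ, F t = u t ξ

/-- The graph of the analytic generator `T` of `u`, that is, of the operator `T` with
`u t = T ^ (i t)`: its elements are the pairs of boundary values at `0` and `-i` of the extensions
of orbit maps to the strip. -/
def Gen (u : ℝ → K ≃ₗᵢ[ℂ] K) (ξ η : K) : Prop := ∃ F : ℂ → K, IsOrbit u ξ F ∧ F (-I) = η

section Orbit

variable {u : ℝ → K ≃ₗᵢ[ℂ] K} {ξ η : K} {F : ℂ → K}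

theorem IsOrbit.unique {G : ℂ → K} (hF : IsOrbit u ξ F) (hG : IsOrbit u ξ G) {z : ℂ}
    (hz : z ∈ strip) : F z = G z :=
  hF.hol.eqOn hG.hol (fun t => by rw [hF.eq, hG.eq]) hz

theorem neg_I_mem_strip : -I ∈ strip := by simp [strip]

theorem Gen.unique {η' : K} (h : Gen u ξ η) (h' : Gen u ξ η') : η = η' := by
  obtain ⟨F, hF, rfl⟩ := h
  obtain ⟨G, hG, rfl⟩ := h'
  exact hF.unique hG neg_I_mem_strip

theorem IsOrbit.clm (hF : IsOrbit u ξ F) (A : K →L[ℂ] K) (hA : ∀ t ζ, A (u t ζ) = u t (A ζ)) :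
    IsOrbit u (A ξ) (fun z => A (F z)) :=
  ⟨hF.hol.clm A, fun t => by rw [hF.eq, hA]⟩

theorem Gen.clm (h : Gen u ξ η) (A : K →L[ℂ] K) (hA : ∀ t ζ, A (u t ζ) = u t (A ζ)) :
    Gen u (A ξ) (A η) := by
  obtain ⟨F, hF, rfl⟩ := h
  exact ⟨_, hF.clm A hA, rfl⟩

theorem Gen.add {ξ' η' : K} (h : Gen u ξ η) (h' : Gen u ξ' η') : Gen u (ξ + ξ') (η + η') := by
  obtain ⟨F, hF, rfl⟩ := h
  obtain ⟨G, hG, rfl⟩ := h'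
  exact ⟨fun z => F z + G z, ⟨hF.hol.add hG.hol, fun t => by rw [hF.eq, hG.eq, map_add]⟩, rfl⟩

theorem Gen.smul (h : Gen u ξ η) (c : ℂ) : Gen u (c • ξ) (c • η) :=
  h.clm (c • ContinuousLinearMap.id ℂ K) (by simp)

theorem Gen.sub {ξ' η' : K} (h : Gen u ξ η) (h' : Gen u ξ' η') : Gen u (ξ - ξ') (η - η') := by
  simpa [sub_eq_add_neg] using h.add (h'.smul (-1))

theorem Gen.zero : Gen u 0 0 :=
  ⟨fun _ => 0, ⟨⟨continuousOn_const, differentiableOn_const _⟩, by simp⟩, rfl⟩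

variable (hu : IsUnitaryGroup u)
include hu

theorem IsOrbit.zero (hF : IsOrbit u ξ F) : F 0 = ξ := by
  have := hF.eq 0
  rwa [ofReal_zero, hu.zero] at this

theorem IsOrbit.add_ofReal (hF : IsOrbit u ξ F) (t : ℝ) {z : ℂ} (hz : z ∈ strip) :
    F (z + t) = u t (F z) :=
  (hF.hol.comp_add_ofReal t).eqOn (hF.hol.clm ((u t : K ≃L[ℂ] K) : K →L[ℂ] K)) (fun s => by
      have := hF.eq (s + t)
      rw [ofReal_add] at this
      rw [this, hF.eq s, add_comm, hu.add]; rfl) hz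

theorem IsOrbit.sub_I (hF : IsOrbit u ξ F) (t : ℝ) : F (t - I) = u t (F (-I)) := by
  rw [sub_eq_neg_add, hF.add_ofReal hu t neg_I_mem_strip]

/-- A semilinear operator that commutes with the group inverts its analytic generator. -/
theorem Gen.semilinear (h : Gen u ξ η) (A : K →L⋆[ℂ] K) (hA : ∀ t ζ, A (u t ζ) = u t (A ζ)) :
    Gen u (A η) (A ξ) := by
  obtain ⟨F, hF, rfl⟩ := h
  refine ⟨_, ⟨hF.hol.semilinear A, fun t => ?_⟩, ?_⟩
  · rw [← hA, ← hF.sub_I hu, conj_ofReal]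
  · simp [hF.zero hu]

theorem Gen.map (h : Gen u ξ η) (t : ℝ) : Gen u (u t ξ) (u t η) :=
  h.clm ((u t : K ≃L[ℂ] K) : K →L[ℂ] K) fun s ζ => hu.comm t s ζ

/-- Orbit maps are bounded on the strip since their norm depends on the imaginary part only. -/
theorem IsOrbit.bounded (hF : IsOrbit u ξ F) : ∃ B, ∀ z ∈ strip, ‖F z‖ ≤ B := by
  have hc : ContinuousOn (fun y : ℝ => F (y * I)) (Icc (-1) 0) :=
    hF.hol.cont.comp (by fun_prop) fun y hy => ⟨by simpa using hy.1, by simpa using hy.2⟩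
  obtain ⟨B, hB⟩ := isCompact_Icc.exists_bound_of_continuousOn hc
  refine ⟨B, fun z hz => ?_⟩
  have hm : (z.im : ℂ) * I ∈ strip := ⟨by simpa using hz.1, by simpa using hz.2⟩
  have h := hF.add_ofReal hu z.re hm
  rw [show (z.im : ℂ) * I + z.re = z by rw [add_comm, re_add_im]] at h
  rw [h, LinearIsometryEquiv.norm_map]
  exact hB _ hz

theorem IsOrbit.norm_le {C : ℝ} (hF : IsOrbit u ξ F) (h0 : ‖ξ‖ ≤ C) (h1 : ‖F (-I)‖ ≤ C) {z : ℂ}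
    (hz : z ∈ strip) : ‖F z‖ ≤ C := by
  obtain ⟨B, hB⟩ := hF.bounded hu
  refine hF.hol.norm_le hB (fun t => ?_) (fun t => ?_) hz
  · rw [hF.eq, LinearIsometryEquiv.norm_map]; exact h0
  · rw [hF.sub_I hu, LinearIsometryEquiv.norm_map]; exact h1

/-- By invariance under real translations, `⟪G (conj z - i), F z⟫` is constant on the strip. -/
theorem IsOrbit.inner_const {ζ : K} {G : ℂ → K} (hF : IsOrbit u ξ F) (hG : IsOrbit u ζ G) {z : ℂ}
    (hz : z ∈ strip) : inner ℂ (G ((starRingEnd ℂ) z - I)) (F z) = inner ℂ (G (-I)) ξ := by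
  refine (hF.hol.inner hG.hol).eqOn ⟨continuousOn_const, differentiableOn_const _⟩ (fun t => ?_) hz
  rw [conj_ofReal, hG.sub_I hu, hF.eq, LinearIsometryEquiv.inner_map_map]

theorem Gen.symm {ζ θ : K} (h : Gen u ξ η) (h' : Gen u ζ θ) : inner ℂ θ ξ = inner ℂ ζ η := by
  obtain ⟨F, hF, rfl⟩ := h
  obtain ⟨G, hG, rfl⟩ := h'
  have h := hF.inner_const hu hG neg_I_mem_strip
  rw [← h]
  simp [hG.zero hu]

/-- `⟪ξ, T ξ⟫` is the square of the norm of the orbit map at `-i/2`. -/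
theorem Gen.nonneg (h : Gen u ξ η) : 0 ≤ (inner ℂ ξ η : ℂ).re := by
  obtain ⟨F, hF, rfl⟩ := h
  have hz : -I / 2 ∈ strip := by constructor <;> simp <;> norm_num
  have h1 := hF.inner_const hu hF hz
  have h2 := hF.inner_const hu hF neg_I_mem_strip
  have h3 : (starRingEnd ℂ) (-I / 2) - I = -I / 2 := by
    simp only [map_div₀, map_neg, conj_I, neg_neg, map_ofNat]; ring
  rw [h3, ← h2] at h1
  have h4 : (starRingEnd ℂ) (-I) - I = 0 := by simp
  rw [h4, hF.zero hu] at h1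
  rw [← h1]
  exact inner_self_nonneg (𝕜 := ℂ)

/-- The analytic generator is closed: by the three lines theorem, convergence of both boundary
values implies uniform convergence on the strip. -/
theorem Gen.of_tendsto {x y : ℕ → K} (h : ∀ n, Gen u (x n) (y n)) (hx : Tendsto x atTop (𝓝 ξ))
    (hy : Tendsto y atTop (𝓝 η)) : Gen u ξ η := by
  choose F hF hFy using h
  have hc : UniformCauchySeqOn F atTop strip := by
    rw [Metric.uniformCauchySeqOn_iff]
    intro ε hε
    obtain ⟨N₁, hN₁⟩ := Metric.cauchySeq_iff.1 hx.cauchySeq (ε / 2) (half_pos hε)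
    obtain ⟨N₂, hN₂⟩ := Metric.cauchySeq_iff.1 hy.cauchySeq (ε / 2) (half_pos hε)
    refine ⟨max N₁ N₂, fun m hm n hn z hz => ?_⟩
    have h1 := hN₁ m (le_of_max_le_left hm) n (le_of_max_le_left hn)
    have h2 := hN₂ m (le_of_max_le_right hm) n (le_of_max_le_right hn)
    rw [dist_eq_norm] at h1 h2 ⊢
    have ho : IsOrbit u (x m - x n) (fun z => F m z - F n z) :=
      ⟨(hF m).hol.sub (hF n).hol, fun t => by rw [(hF m).eq, (hF n).eq, map_sub]⟩
    have := ho.norm_le hu h1.le (by rw [hFy, hFy]; exact h2.le) hz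
    linarith
  have hlim : ∀ z ∈ strip, ∃ w, Tendsto (fun n => F n z) atTop (𝓝 w) := fun z hz =>
    cauchySeq_tendsto_of_complete (hc.cauchySeq hz)
  choose! L hL using hlim
  have hu' : TendstoUniformlyOn F L atTop strip := hc.tendstoUniformlyOn_of_tendsto hL
  have hsub : openStrip ⊆ strip := fun z hz => ⟨hz.1.le, hz.2.le⟩
  refine ⟨L, ⟨⟨hu'.continuousOn (Frequently.of_forall fun n => (hF n).hol.cont), ?_⟩,
    fun t => ?_⟩, ?_⟩
  · exact (hu'.mono hsub).tendstoLocallyUniformlyOn.differentiableOn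
      (Eventually.of_forall fun n => (hF n).hol.diff) isOpen_openStrip
  · refine tendsto_nhds_unique (hL _ (ofReal_mem_strip t)) ?_
    simp_rw [(hF _).eq]
    exact ((u t).continuous.tendsto ξ).comp hx
  · refine tendsto_nhds_unique (hL _ neg_I_mem_strip) ?_
    simp_rw [hFy]
    exact hy

theorem gen_of_entire (hF : Differentiable ℂ F) (hs : ∀ z (t : ℝ), F (z + t) = u t (F z)) (w : ℂ) :
    Gen u (F w) (F (w - I)) := by
  refine ⟨fun z => F (w + z), ⟨⟨?_, ?_⟩, fun t => hs w t⟩, by rw [sub_eq_add_neg]⟩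
  · exact (hF.continuous.comp (by fun_prop)).continuousOn
  · exact (hF.comp (by fun_prop)).differentiableOn

theorem exists_gen_smoothing {δ : ℝ} (hδ : 0 < δ) (ζ : K) : ∃ η, Gen u (smoothing u hu δ ζ) η := by
  obtain ⟨F, hF, hs, h0⟩ := exists_entire_orbit hu hδ ζ
  exact ⟨_, h0 ▸ gen_of_entire hu hF hs 0⟩

theorem dense_gen : Dense {ξ | ∃ η, Gen u ξ η} := fun ζ =>
  mem_closure_of_tendsto (tendsto_smoothing hu ζ)
    (Eventually.of_forall fun n => exists_gen_smoothing hu (Nat.one_div_pos_of_nat (n := n)) ζ)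

/-- The analytic generator contains its adjoint: Gaussian averages of elements of the graph of the
adjoint lie in the graph of the generator, and they converge. -/
theorem Gen.of_adjoint (h : ∀ x y, Gen u x y → inner ℂ η x = inner ℂ ξ y) : Gen u ξ η := by
  refine Gen.of_tendsto hu (fun n => ?_) (tendsto_smoothing hu ξ) (tendsto_smoothing hu η)
  set δ : ℝ := 1 / ((n : ℝ) + 1)
  obtain ⟨θ, hθ⟩ := exists_gen_smoothing hu (Nat.one_div_pos_of_nat (n := n)) ξ
  have : θ = smoothing u hu δ η := by
    refine (dense_gen hu).eq_of_inner_left ℂ ?_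
    rintro x ⟨y, hxy⟩
    have h1 := h _ _ (hxy.clm (smoothing u hu δ) fun t ζ => smoothing_comm hu δ t ζ)
    rw [← inner_smoothing, ← inner_smoothing] at h1
    rw [h1]
    exact hxy.symm hu hθ
  exact this ▸ hθ

end Orbit

/-- The graph of the analytic generator of `u` as a submodule. -/
def genGraph (u : ℝ → K ≃ₗᵢ[ℂ] K) : Submodule ℂ (K × K) where
  carrier := {p | Gen u p.1 p.2}
  add_mem' := fun h h' => h.add h'
  zero_mem' := Gen.zero
  smul_mem' := fun c _ h => h.smul c

/-- The analytic generator of a one-parameter unitary group, as an unbounded operator. -/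
def generator (u : ℝ → K ≃ₗᵢ[ℂ] K) : K →ₗ.[ℂ] K := (genGraph u).toLinearPMap

variable {u : ℝ → K ≃ₗᵢ[ℂ] K}

theorem generator_graph : (generator u).graph = genGraph u :=
  Submodule.toLinearPMap_graph_eq _ fun p hp h0 => by
    have hp' : Gen u p.1 p.2 := hp
    rw [h0] at hp'
    exact hp'.unique Gen.zero

theorem generator_iff {ξ η : K} :
    (∃ h : ξ ∈ (generator u).domain, generator u ⟨ξ, h⟩ = η) ↔ Gen u ξ η := by
  have h : (ξ, η) ∈ (generator u).graph ↔ Gen u ξ η := by rw [generator_graph]; rfl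
  rw [← h, LinearPMap.mem_graph_iff]
  constructor
  · rintro ⟨h, h'⟩; exact ⟨⟨ξ, h⟩, rfl, h'⟩
  · rintro ⟨⟨y, hy⟩, rfl, h'⟩; exact ⟨hy, h'⟩

theorem gen_generator (ξ : (generator u).domain) : Gen u ξ (generator u ξ) :=
  generator_iff.1 ⟨ξ.2, rfl⟩

theorem dense_generator (hu : IsUnitaryGroup u) : Dense ((generator u).domain : Set K) := by
  refine (dense_gen hu).mono ?_
  rintro ξ ⟨η, h⟩
  exact (generator_iff.2 h).choose

/-- The analytic generator of a one-parameter unitary group is self-adjoint. -/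
theorem isSelfAdjoint_generator (hu : IsUnitaryGroup u) : IsSelfAdjoint (generator u) := by
  rw [LinearPMap.isSelfAdjoint_def]
  have hd := dense_generator hu
  refine le_antisymm ?_ ?_
  · rw [← LinearPMap.le_graph_iff]
    rintro ⟨ξ, η⟩ hp
    rw [LinearPMap.mem_graph_iff] at hp
    obtain ⟨y, rfl, rfl⟩ := hp
    rw [generator_graph]
    refine Gen.of_adjoint hu fun x z hxz => ?_
    obtain ⟨hx, rfl⟩ := generator_iff.2 hxz
    exact (LinearPMap.adjoint_isFormalAdjoint hd y ⟨x, hx⟩)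
  · refine LinearPMap.IsFormalAdjoint.le_adjoint hd fun x y => ?_
    exact ((gen_generator y).symm hu (gen_generator x))

end Generator

/-! ### Modular theory of standard subspaces -/

section ModularTheory

open Complex Set Filter Topology

variable {K : Type*} [NormedAddCommGroup K] [InnerProductSpace ℂ K] [CompleteSpace K]

section Uniqueness

variable {u v : ℝ → K ≃ₗᵢ[ℂ] K} (hu : IsUnitaryGroup u) (hv : IsUnitaryGroup v)

/-- The graph of the square `T ^ 2` of the analytic generator `T` of `u`. -/
def GenSq (u : ℝ → K ≃ₗᵢ[ℂ] K) (ξ θ : K) : Prop := ∃ η, Gen u ξ η ∧ Gen u η θ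

include hu in
theorem GenSq.symm {ξ θ ξ' θ' : K} (h : GenSq u ξ θ) (h' : GenSq u ξ' θ') :
    inner ℂ θ' ξ = inner ℂ ξ' θ := by
  obtain ⟨η, h1, h2⟩ := h
  obtain ⟨η', h1', h2'⟩ := h'
  rw [Gen.symm hu h1 h2', Gen.symm hu h2 h1']

include hu in
theorem dense_genSq_domain : Dense {ξ | ∃ θ, GenSq u ξ θ} := fun ζ =>
  mem_closure_of_tendsto (tendsto_smoothing hu ζ) (Eventually.of_forall fun n => by
    obtain ⟨F, hF, hs, h0⟩ := exists_entire_orbit hu (Nat.one_div_pos_of_nat (n := n)) ζ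
    rw [← h0]
    exact ⟨_, _, gen_of_entire hu hF hs 0, gen_of_entire hu hF hs _⟩)

include hu in
theorem dense_genSq_range : Dense {θ | ∃ ξ, GenSq u ξ θ} := fun ζ =>
  mem_closure_of_tendsto (tendsto_smoothing hu ζ) (Eventually.of_forall fun n => by
    obtain ⟨F, hF, hs, h0⟩ := exists_entire_orbit hu (Nat.one_div_pos_of_nat (n := n)) ζ
    rw [← h0]
    refine ⟨F (I + I), F I, ?_, ?_⟩
    · simpa using gen_of_entire hu hF hs (I + I)
    · simpa using gen_of_entire hu hF hs I)

include hu hv in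
/-- A one-parameter unitary group is determined by the square of its analytic generator: if the
generators of `u` and `v` have the same square `T²`, the function `t ↦ ⟪v t (T² ξ'), u t ξ⟫` extends
to a bounded entire function with period `2i`, so that it is constant. -/
theorem eq_of_genSq (h : ∀ ξ θ, GenSq u ξ θ → GenSq v ξ θ) (t : ℝ) (ξ : K) : u t ξ = v t ξ := by
  have key : ∀ ξ θ ξ' θ', GenSq u ξ θ → GenSq v ξ' θ' →
      inner ℂ (v t θ') (u t ξ) = inner ℂ θ' ξ := by
    rintro ξ θ ξ' θ' hξ hξ'
    obtain ⟨η, ⟨F₁, hF₁, rfl⟩, ⟨F₂, hF₂, rfl⟩⟩ := id hξ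
    obtain ⟨η', ⟨G₁, hG₁, rfl⟩, ⟨G₂, hG₂, rfl⟩⟩ := id hξ'
    -- the function `⟪v t θ', u t ξ⟫` is continued from `Im z = 0` to `Im z = -1` by the orbits of
    -- `ξ` and `T ξ'`, and from there to `Im z = -2` by the orbits of `T ξ` and `ξ'`
    set k : ℤ → ℂ → ℂ := fun n z => if Even n then inner ℂ (G₂ ((starRingEnd ℂ) z - I)) (F₁ z)
      else inner ℂ (G₁ ((starRingEnd ℂ) z - I)) (F₂ z) with hk
    have hbd : ∀ {α β : K} {F G : ℂ → K}, IsOrbit u α F → IsOrbit v β G →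
        ∃ C, ∀ z ∈ strip, ‖(inner ℂ (G ((starRingEnd ℂ) z - I)) (F z) : ℂ)‖ ≤ C := by
      intro α β F G hF hG
      obtain ⟨B, hB⟩ := hF.bounded hu
      obtain ⟨B', hB'⟩ := hG.bounded hv
      refine ⟨B' * B, fun z hz => (norm_inner_le_norm _ _).trans ?_⟩
      have hz' : (starRingEnd ℂ) z - I ∈ strip :=
        ⟨by simpa using hz.2, by simpa [neg_le] using hz.1⟩
      exact mul_le_mul (hB' _ hz') (hB _ hz) (norm_nonneg _) ((norm_nonneg _).trans (hB' _ hz'))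
    obtain ⟨C₁, hC₁⟩ := hbd hF₁ hG₂
    obtain ⟨C₂, hC₂⟩ := hbd hF₂ hG₁
    have hglue := eq_of_glue k (C := max C₁ C₂) (fun n => ?_) (fun n z hz => ?_) (fun n s => ?_) t
    · simp only [hk, Even.zero, if_true, conj_ofReal, hF₁.eq, hG₂.sub_I hv, map_zero, zero_sub,
        hF₁.zero hu] at hglue
      exact hglue
    · by_cases hn : Even n
      · simp only [hk, hn, if_true]; exact hF₁.hol.inner hG₂.hol
      · simp only [hk, hn, if_false]; exact hF₂.hol.inner hG₁.hol
    · by_cases hn : Even n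
      · simp only [hk, hn, if_true]; exact (hC₁ z hz).trans (le_max_left _ _)
      · simp only [hk, hn, if_false]; exact (hC₂ z hz).trans (le_max_right _ _)
    · have hcs : (starRingEnd ℂ) (s - I) - I = s := by simp
      by_cases hn : Even n
      · have hn' : ¬ Even (n - 1) := by rw [Int.not_even_iff_odd]; exact hn.sub_odd odd_one
        simp only [hk, hn, hn', if_true, if_false, hcs, conj_ofReal, hF₁.sub_I hu, hG₁.sub_I hv,
          hF₂.eq, hG₂.eq]
      · have hn' : Even (n - 1) := (Int.not_even_iff_odd.1 hn).sub_odd odd_one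
        simp only [hk, hn, hn', if_true, if_false, hcs, conj_ofReal, hF₂.sub_I hu, hG₂.sub_I hv,
          hF₁.eq, hG₁.eq]
        -- the values at `Im z = -2` and `Im z = 0` agree since `T²` is symmetric
        have h1 : GenSq u (u s ξ) (u s (F₂ (-I))) :=
          ⟨_, Gen.map hu ⟨F₁, hF₁, rfl⟩ s, Gen.map hu ⟨F₂, hF₂, rfl⟩ s⟩
        have h2 : GenSq v (v s ξ') (v s (G₂ (-I))) :=
          ⟨_, Gen.map hv ⟨G₁, hG₁, rfl⟩ s, Gen.map hv ⟨G₂, hG₂, rfl⟩ s⟩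
        exact (GenSq.symm hv (h _ _ h1) h2).symm
  have hd : EqOn (fun ξ => u t ξ) (fun ξ => v t ξ) {ξ | ∃ θ, GenSq u ξ θ} := by
    rintro ξ ⟨θ, hξ⟩
    have h1 : v (-t) (u t ξ) = ξ := by
      refine (dense_genSq_range hv).eq_of_inner_right ℂ ?_
      rintro θ' ⟨ξ', hξ'⟩
      rw [← key ξ θ ξ' θ' hξ hξ', hv.inner_apply]
    change u t ξ = v t ξ
    rw [← hv.apply_neg t (u t ξ), h1]
  exact congrFun (Continuous.ext_on (dense_genSq_domain hu) (u t).continuous (v t).continuous hd) ξ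

include hu hv in
/-- Uniqueness in the polar decomposition: if the generators `T` of `u` and `T'` of `v` satisfy
`T' = W T` with a unitary operator `W`, then `T'² = T'* T' = T* T = T²`. -/
theorem eq_of_gen_unitary (W : K ≃ₗᵢ[ℂ] K) (h : ∀ ξ η, Gen u ξ η ↔ Gen v ξ (W η)) (t : ℝ) (ξ : K) :
    u t ξ = v t ξ := by
  refine eq_of_genSq hu hv ?_ t ξ
  rintro ξ θ ⟨η, h1, h2⟩
  refine ⟨W η, (h _ _).1 h1, Gen.of_adjoint hv fun x y hxy => ?_⟩
  have hxy' : Gen u x (W.symm y) := (h _ _).2 (by rwa [W.apply_symm_apply])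
  rw [Gen.symm hu hxy' h2, ← W.inner_map_map, W.apply_symm_apply]

end Uniqueness

/-- A standard subspace is the fixed point set of its Tomita operator. -/
theorem mem_tomitaGraph_self {V : StandardSubspace K} {ξ : K} :
    (ξ, ξ) ∈ tomitaGraph V ↔ ξ ∈ V.toClosedSubmodule := by
  constructor
  · rintro ⟨a, ha, b, hb, h⟩
    obtain ⟨h1, h2⟩ := Prod.mk.inj h
    have h3 : (2 : ℂ) • (I • b) = 0 := by
      have : a + I • b - (a - I • b) = 0 := by rw [← h1, ← h2, sub_self]
      rw [two_smul, ← this]; abel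
    have h4 : I • b = 0 := by simpa using h3
    rw [h1, h4, add_zero]; exact ha
  · intro h
    exact ⟨ξ, h, 0, V.toClosedSubmodule.zero_mem, by simp⟩

theorem StandardSubspace.eq_of_tomitaGraph {V V' : StandardSubspace K}
    (h : tomitaGraph V = tomitaGraph V') : V = V' := by
  apply StandardSubspace.toClosedSubmodule_injective
  apply SetLike.ext
  intro ξ
  rw [← mem_tomitaGraph_self, h, mem_tomitaGraph_self]

/-- A modular pair `(J, δ)` of `V` consists of an antiunitary operator and a one-parameter group
such that the Tomita operator of `V` is `J` times the analytic generator of `t ↦ δ (t / 2)`; the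
self-adjointness and positivity of the generator are automatic. -/
theorem isModularPair_iff {V : StandardSubspace K} {J : K ≃ₗᵢ⋆[ℂ] K} {δ : ℝ → K ≃ₗᵢ[ℂ] K} :
    IsModularPair V J δ ↔ IsUnitaryGroup (fun t => δ (t / 2)) ∧
      ∀ ξ η, (ξ, J η) ∈ tomitaGraph V ↔ Gen (fun t => δ (t / 2)) ξ η := by
  constructor
  · rintro ⟨T, hT, hP⟩
    refine ⟨⟨hP.add, hP.continuous⟩, fun ξ η => ?_⟩
    have h1 : Gen (fun t => δ (t / 2)) ξ η ↔ ∃ h : ξ ∈ T.domain, T ⟨ξ, h⟩ = η := by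
      rw [hP.graph]
      constructor
      · rintro ⟨F, hF, h⟩; exact ⟨F, hF.hol.cont, hF.hol.diff, hF.eq, h⟩
      · rintro ⟨F, h1, h2, h3, h4⟩; exact ⟨F, ⟨⟨h1, h2⟩, h3⟩, h4⟩
    rw [h1, hT.graph]
    simp only [mem_ofPred_eq, J.injective.eq_iff]
  · rintro ⟨hu, h⟩
    refine ⟨generator fun t => δ (t / 2), ⟨dense_generator hu, isSelfAdjoint_generator hu,
      fun ξ => (gen_generator ξ).nonneg hu, ?_⟩, ⟨hu.add, hu.continuous, fun ξ η => ?_⟩⟩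
    · ext ⟨ξ, η⟩
      have h1 := h ξ (J.symm η)
      rw [J.apply_symm_apply, ← generator_iff] at h1
      rw [h1]
      simp only [mem_ofPred_eq]
      constructor
      · rintro ⟨hξ, h2⟩; exact ⟨hξ, by rw [h2, J.apply_symm_apply]⟩
      · rintro ⟨hξ, h2⟩; exact ⟨hξ, by rw [← h2, J.symm_apply_apply]⟩
    · rw [generator_iff]
      constructor
      · rintro ⟨F, hF, h⟩; exact ⟨F, hF.hol.cont, hF.hol.diff, hF.eq, h⟩
      · rintro ⟨F, h1, h2, h3, h4⟩; exact ⟨F, ⟨⟨h1, h2⟩, h3⟩, h4⟩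

theorem IsModularPair.standard_unique {V V' : StandardSubspace K} {J : K ≃ₗᵢ⋆[ℂ] K}
    {δ : ℝ → K ≃ₗᵢ[ℂ] K} (h : IsModularPair V J δ) (h' : IsModularPair V' J δ) : V = V' := by
  apply StandardSubspace.eq_of_tomitaGraph
  ext ⟨ξ, η⟩
  have h1 := (isModularPair_iff.1 h).2 ξ (J.symm η)
  have h2 := (isModularPair_iff.1 h').2 ξ (J.symm η)
  rw [J.apply_symm_apply] at h1 h2
  rw [h1, h2]

theorem IsModularPair.group_unique {V : StandardSubspace K} {J J' : K ≃ₗᵢ⋆[ℂ] K}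
    {δ δ' : ℝ → K ≃ₗᵢ[ℂ] K} (h : IsModularPair V J δ) (h' : IsModularPair V J' δ') : δ = δ' := by
  rw [isModularPair_iff] at h h'
  funext t
  ext ξ
  have := eq_of_gen_unitary h.1 h'.1 (J.trans J'.symm) (fun ξ η => ?_) (2 * t) ξ
  · simpa using this
  · rw [← h.2, ← h'.2]
    simp

theorem IsModularPair.modularGroup_eq {V : StandardSubspace K} {J : K ≃ₗᵢ⋆[ℂ] K}
    {δ : ℝ → K ≃ₗᵢ[ℂ] K} (h : IsModularPair V J δ) : modularGroup V = δ := by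
  have hex : ∃ δ : ℝ → K ≃ₗᵢ[ℂ] K, ∃ J : K ≃ₗᵢ⋆[ℂ] K, IsModularPair V J δ := ⟨δ, J, h⟩
  rw [modularGroup, dif_pos hex]
  exact hex.choose_spec.choose_spec.group_unique h

theorem mem_mulI_iff {V : ClosedSubmodule ℝ K} {ξ : K} : ξ ∈ V.mulI ↔ I • ξ ∈ V := by
  rw [ClosedSubmodule.mem_mapEquiv_iff]
  have h : (scalarSMulCLE K UnitI).symm ξ = -(I • ξ) := by
    rw [scalarSMulCLE_symm_apply, Units.smul_def, Units.val_inv_eq_inv_val, val_UnitI, inv_I,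
      neg_smul]
  rw [h]
  exact V.toSubmodule.neg_mem_iff

section Existence

variable {u : ℝ → K ≃ₗᵢ[ℂ] K} (hu : IsUnitaryGroup u) (J : K ≃ₗᵢ⋆[ℂ] K)
  (hJ : ∀ ξ, J (J ξ) = ξ) (hJu : ∀ t ξ, J (u t ξ) = u t (J ξ))

/-- The closed real subspace `{ξ | J T ξ = ξ}` of fixed points of the involution `J T`, where `T` is
the analytic generator of `u`. -/
def fixedSubspace : ClosedSubmodule ℝ K where
  carrier := {ξ | Gen u ξ (J.symm ξ)}
  add_mem' := fun {a b} h h' => by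
    change Gen u (a + b) (J.symm (a + b))
    rw [map_add]; exact Gen.add h h'
  zero_mem' := by
    change Gen u 0 (J.symm 0)
    rw [map_zero]; exact Gen.zero
  smul_mem' := fun c x h => by
    change Gen u (c • x) (J.symm (c • x))
    have h1 : c • x = (c : ℂ) • x := (coe_smul c x).symm
    rw [h1, LinearIsometryEquiv.map_smulₛₗ, conj_ofReal]
    exact Gen.smul h c
  isClosed' := by
    refine isSeqClosed_iff_isClosed.1 fun x ξ hx hlim => ?_
    exact Gen.of_tendsto hu hx hlim ((J.symm.continuous.tendsto ξ).comp hlim)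

theorem mem_fixedSubspace {ξ : K} : ξ ∈ fixedSubspace hu J ↔ Gen u ξ (J.symm ξ) := Iff.rfl

include hJ in
theorem symm_eq_of_involution (ξ : K) : J.symm ξ = J ξ := by
  rw [← hJ ξ, J.symm_apply_apply, hJ]

include hJ hJu in
/-- Since `J T` is an involution, an element of the domain of `T` is the sum of an element that is
fixed by `J T` and of `i` times such an element. -/
theorem exists_decomposition {ξ η : K} (h : Gen u ξ η) : ∃ a ∈ fixedSubspace hu J,
    ∃ b ∈ fixedSubspace hu J, ξ = a + I • b ∧ J η = a - I • b := by
  have h' : Gen u (J η) (J ξ) :=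
    h.semilinear hu (J.toContinuousLinearEquiv : K →L⋆[ℂ] K) hJu
  -- the summands are `a = (ξ + J η) / 2` and `b = (ξ - J η) / (2 i)`, where `J η = J T ξ`
  refine ⟨(2 : ℂ)⁻¹ • (ξ + J η), ?_, (-(I * 2⁻¹)) • (ξ - J η), ?_, ?_, ?_⟩
  · rw [mem_fixedSubspace, symm_eq_of_involution J hJ]
    convert! (h.add h').smul (2 : ℂ)⁻¹ using 1
    simp only [LinearIsometryEquiv.map_smulₛₗ, map_add, hJ, map_inv₀, map_ofNat]
    rw [add_comm]
  · rw [mem_fixedSubspace, symm_eq_of_involution J hJ]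
    convert! (h.sub h').smul (-(I * 2⁻¹)) using 1
    simp only [LinearIsometryEquiv.map_smulₛₗ, map_sub, hJ, map_inv₀, map_ofNat, map_neg, map_mul,
      conj_I]
    rw [neg_mul, neg_neg, ← neg_sub η, smul_neg, neg_smul]
  all_goals
    have h1 : I * -(I * 2⁻¹) = 2⁻¹ := by rw [mul_neg, ← mul_assoc, I_mul_I]; ring
    rw [smul_smul, h1]
    module

/-- For an antiunitary involution `J` commuting with `u`, the fixed points of `J T` form a standard
subspace, where `T` is the analytic generator of `u`. -/
def fixedStandard : StandardSubspace K where
  toClosedSubmodule := fixedSubspace hu J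
  IsSeparating := by
    rw [eq_bot_iff]
    intro ξ hξ
    obtain ⟨h1, h2⟩ := ClosedSubmodule.mem_inf.1 hξ
    rw [mem_mulI_iff, mem_fixedSubspace, LinearIsometryEquiv.map_smulₛₗ, conj_I] at h2
    have h3 := h2.unique (Gen.smul h1 I)
    have h4 : (2 : ℂ) • (I • J.symm ξ) = 0 := by
      rw [two_smul]
      nth_rewrite 1 [← h3]
      rw [neg_smul, neg_add_cancel]
    have h5 : J.symm ξ = 0 := by simpa using h4
    exact ClosedSubmodule.mem_bot.2 (by simpa using h5)
  IsCyclic := by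
    rw [eq_top_iff]
    intro ξ _
    set S := fixedSubspace hu J ⊔ (fixedSubspace hu J).mulI with hS
    have hsub : {ξ | ∃ η, Gen u ξ η} ⊆ (S : Set K) := by
      rintro ξ ⟨η, h⟩
      obtain ⟨a, ha, b, hb, rfl, -⟩ := exists_decomposition hu J hJ hJu h
      refine add_mem ((le_sup_left : fixedSubspace hu J ≤ S) ha)
        ((le_sup_right : (fixedSubspace hu J).mulI ≤ S) ?_)
      rw [mem_mulI_iff, smul_smul, I_mul_I, neg_one_smul]
      exact (fixedSubspace hu J).toSubmodule.neg_mem hb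
    exact S.isClosed.closure_subset_iff.2 hsub (dense_gen hu ξ)

theorem tomitaGraph_fixedStandard (ξ η : K) :
    (ξ, J η) ∈ tomitaGraph (fixedStandard hu J hJ hJu) ↔ Gen u ξ η := by
  constructor
  · rintro ⟨a, ha, b, hb, h⟩
    obtain ⟨rfl, h2⟩ := Prod.mk.inj h
    have h3 : η = J.symm a + I • J.symm b := by
      rw [← J.symm_apply_apply η, h2, map_sub, LinearIsometryEquiv.map_smulₛₗ, conj_I, neg_smul,
        sub_neg_eq_add]
    rw [h3]
    exact Gen.add ha (Gen.smul hb I)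
  · intro h
    obtain ⟨a, ha, b, hb, h1, h2⟩ := exists_decomposition hu J hJ hJu h
    exact ⟨a, ha, b, hb, by rw [h1, h2]⟩

end Existence

/-- An antiunitary involution and a one-parameter group commuting with it are the modular objects of
a standard subspace. -/
theorem exists_isModularPair {J : K ≃ₗᵢ⋆[ℂ] K} {δ : ℝ → K ≃ₗᵢ[ℂ] K} (hδ : IsUnitaryGroup δ)
    (hJ : ∀ ξ, J (J ξ) = ξ) (hJδ : ∀ t ξ, J (δ t ξ) = δ t (J ξ)) :
    ∃ V : StandardSubspace K, IsModularPair V J δ := by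
  have hu : IsUnitaryGroup fun t => δ (t / 2) := by
    have := hδ.scale (1 / 2)
    simpa only [one_div_mul_eq_div] using this
  exact ⟨fixedStandard hu J hJ fun t ξ => hJδ _ ξ,
    isModularPair_iff.2 ⟨hu, tomitaGraph_fixedStandard hu J hJ fun t ξ => hJδ _ ξ⟩⟩

section Image

theorem mem_image {A : K ≃ₗᵢ[ℝ] K} {V : ClosedSubmodule ℝ K} {ξ : K} :
    ξ ∈ image A V ↔ A.symm ξ ∈ V := ClosedSubmodule.mem_mapEquiv_iff _ _ _

theorem image_mul (A B : K ≃ₗᵢ[ℝ] K) (V : ClosedSubmodule ℝ K) :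
    image (A * B) V = image A (image B V) := by
  apply SetLike.ext
  intro ξ
  rw [mem_image, mem_image, mem_image]; rfl

/-- The image of a standard subspace under a unitary operator. -/
def unitaryImage (A : K ≃ₗᵢ[ℂ] K) (V : StandardSubspace K) : StandardSubspace K where
  toClosedSubmodule := image (toReal A) V.toClosedSubmodule
  IsSeparating := by
    rw [eq_bot_iff]
    intro ξ hξ
    obtain ⟨h1, h2⟩ := ClosedSubmodule.mem_inf.1 hξ
    rw [mem_mulI_iff, mem_image] at h2
    rw [mem_image] at h1
    have h3 : A.symm ξ ∈ V.toClosedSubmodule ⊓ V.toClosedSubmodule.mulI := by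
      refine ClosedSubmodule.mem_inf.2 ⟨h1, ?_⟩
      rw [mem_mulI_iff, ← map_smul]; exact h2
    rw [V.IsSeparating, ClosedSubmodule.mem_bot] at h3
    exact ClosedSubmodule.mem_bot.2 (by simpa using h3)
  IsCyclic := by
    have h : (image (toReal A) V.toClosedSubmodule).mulI =
        image (toReal A) V.toClosedSubmodule.mulI := by
      apply SetLike.ext
      intro ξ
      rw [mem_mulI_iff, mem_image, mem_image, mem_mulI_iff]
      have : (toReal A).symm (I • ξ) = I • (toReal A).symm ξ := A.symm.map_smul I ξ
      rw [this]
    rw [h, image, image, ← ClosedSubmodule.mapEquiv_sup_eq, V.IsCyclic,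
      ClosedSubmodule.mapEquiv_top_eq_top]

theorem tomitaGraph_unitaryImage (A : K ≃ₗᵢ[ℂ] K) (V : StandardSubspace K) (ξ η : K) :
    (ξ, η) ∈ tomitaGraph (unitaryImage A V) ↔ (A.symm ξ, A.symm η) ∈ tomitaGraph V := by
  constructor
  · rintro ⟨a, ha, b, hb, h⟩
    obtain ⟨rfl, rfl⟩ := Prod.mk.inj h
    exact ⟨A.symm a, mem_image.1 ha, A.symm b, mem_image.1 hb, by simp⟩
  · rintro ⟨a, ha, b, hb, h⟩
    obtain ⟨h1, h2⟩ := Prod.mk.inj h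
    refine ⟨A a, ?_, A b, ?_, ?_⟩
    · exact mem_image.2 (show A.symm (A a) ∈ _ by rwa [A.symm_apply_apply])
    · exact mem_image.2 (show A.symm (A b) ∈ _ by rwa [A.symm_apply_apply])
    · rw [← map_smul, ← map_add, ← map_sub, ← h1, ← h2, A.apply_symm_apply, A.apply_symm_apply]

/-- Modular objects are covariant under unitary operators. -/
theorem IsModularPair.unitaryImage {V : StandardSubspace K} {J J' : K ≃ₗᵢ⋆[ℂ] K}
    {δ δ' : ℝ → K ≃ₗᵢ[ℂ] K} (h : IsModularPair V J δ) (A : K ≃ₗᵢ[ℂ] K)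
    (hJ : ∀ ξ, J' (A ξ) = A (J ξ)) (hδ : ∀ t ξ, δ' t (A ξ) = A (δ t ξ)) :
    IsModularPair (unitaryImage A V) J' δ' := by
  rw [isModularPair_iff] at h ⊢
  obtain ⟨hu, hg⟩ := h
  have hδ' : ∀ t ξ, δ' t ξ = A (δ t (A.symm ξ)) := fun t ξ => by
    rw [← hδ, A.apply_symm_apply]
  refine ⟨⟨fun s t ξ => ?_, fun ξ => ?_⟩, fun ξ η => ?_⟩
  · simp only [hδ', A.symm_apply_apply]
    rw [← hu.add]
  · simp only [hδ']
    exact A.continuous.comp (hu.continuous _)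
  · have h1 : A.symm (J' η) = J (A.symm η) := by
      rw [← A.apply_symm_apply η, hJ, A.symm_apply_apply, A.symm_apply_apply]
    rw [tomitaGraph_unitaryImage, h1, hg]
    have hA : ∀ (w : ℝ → K ≃ₗᵢ[ℂ] K) (w' : ℝ → K ≃ₗᵢ[ℂ] K) (B : K ≃ₗᵢ[ℂ] K),
        (∀ t ξ, w' t (B ξ) = B (w t ξ)) → ∀ ξ η, Gen w ξ η → Gen w' (B ξ) (B η) := by
      rintro w w' B hB ξ _ ⟨F, hF, rfl⟩
      exact ⟨fun z => B (F z), ⟨hF.hol.clm ((B : K ≃L[ℂ] K) : K →L[ℂ] K),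
        fun t => by rw [hF.eq, hB]⟩, rfl⟩
    constructor
    · intro h
      simpa using hA _ (fun t => δ' (t / 2)) A (fun t ξ => hδ _ ξ) _ _ h
    · intro h
      exact hA _ _ A.symm (fun t ξ => by rw [hδ', A.symm_apply_apply]) _ _ h

end Image

end ModularTheory

/-! ### Brunetti-Guido-Longo subspaces -/

section BGL

variable {E G : Type*} [NormedAddCommGroup E] [NormedSpace ℝ E] [CompleteSpace E]
  [TopologicalSpace G] [T2Space G] [ChartedSpace E G] [Group G] [LieGroup 𝓘(ℝ, E) ∞ G]
  {K : Type*} [NormedAddCommGroup K] [InnerProductSpace ℂ K] [CompleteSpace K]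
  {ε : G →* ℤˣ} {U : G →* (K ≃ₗᵢ[ℝ] K)}

/-- A complex-linear real isometry as a unitary operator. -/
def unitaryOf (A : K ≃ₗᵢ[ℝ] K) (h : ∀ (c : ℂ) (ξ : K), A (c • ξ) = c • A ξ) : K ≃ₗᵢ[ℂ] K where
  toFun := A
  invFun := A.symm
  left_inv := A.symm_apply_apply
  right_inv := A.apply_symm_apply
  map_add' := map_add A
  map_smul' := h
  norm_map' := A.norm_map

/-- A conjugate-linear real isometry as an antiunitary operator. -/
def antiunitaryOf (A : K ≃ₗᵢ[ℝ] K)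
    (h : ∀ (c : ℂ) (ξ : K), A (c • ξ) = (starRingEnd ℂ c) • A ξ) : K ≃ₗᵢ⋆[ℂ] K where
  toFun := A
  invFun := A.symm
  left_inv := A.symm_apply_apply
  right_inv := A.apply_symm_apply
  map_add' := map_add A
  map_smul' := h
  norm_map' := A.norm_map

/-- One-parameter groups are even, since their elements are squares. -/
theorem grading_lieExp (ε : G →* ℤˣ) (x : GroupLieAlgebra 𝓘(ℝ, E) G) (t : ℝ) :
    ε (lieExp (t • x)) = 1 := by
  rw [← add_halves t, lieExp_add_smul, map_mul, Int.units_mul_self]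

theorem wedgeAct_of_even {g : G} (hg : ε g = 1) (W : GroupLieAlgebra 𝓘(ℝ, E) G × G) :
    wedgeAct ε g W = (Ad g W.1, g * W.2 * g⁻¹) := by
  simp [wedgeAct, hg]

theorem wedgeAct_mul (g h : G) (W : GroupLieAlgebra 𝓘(ℝ, E) G × G) :
    wedgeAct ε (g * h) W = wedgeAct ε g (wedgeAct ε h W) := by
  unfold wedgeAct
  refine Prod.ext ?_ ?_
  · simp only [map_mul, Units.val_mul, Int.cast_mul]
    rw [Ad_mul, Ad_smul, smul_smul]
  · simp [mul_assoc]

theorem wedgeAct_one (W : GroupLieAlgebra 𝓘(ℝ, E) G × G) : wedgeAct ε 1 W = W := by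
  rw [wedgeAct_of_even (map_one ε), Ad_one]; simp

theorem wedgeFlow_wedgeAct {g : G} (hg : ε g = 1) (W : GroupLieAlgebra 𝓘(ℝ, E) G × G) (t : ℝ) :
    wedgeFlow (wedgeAct ε g W) t = g * wedgeFlow W t * g⁻¹ := by
  rw [wedgeAct_of_even hg]
  exact lieExp_Ad g W.1 t

theorem conj_wedgeFlow {g : G} (hg : ε g = 1) {W : GroupLieAlgebra 𝓘(ℝ, E) G × G}
    (h : wedgeAct ε g W = W) (t : ℝ) : g * wedgeFlow W t * g⁻¹ = wedgeFlow W t := by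
  rw [← wedgeFlow_wedgeAct hg, h]

/-- The one-parameter group of an element of the wedge space fixes that element. -/
theorem wedgeAct_wedgeFlow {W : GroupLieAlgebra 𝓘(ℝ, E) G × G} (hW : W ∈ wedgeSpace ε) (t : ℝ) :
    wedgeAct ε (wedgeFlow W t) W = W := by
  rw [wedgeAct_of_even (g := wedgeFlow W t) (grading_lieExp ε W.1 t)]
  refine Prod.ext ?_ ?_
  · refine Ad_eq_of_conj_lieExp fun s => ?_
    rw [wedgeFlow, mul_inv_eq_iff_eq_mul, ← lieExp_add_smul, add_comm, lieExp_add_smul]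
  · have h := lieExp_Ad W.2 W.1 t
    rw [hW.2.2, eq_mul_inv_iff_mul_eq] at h
    exact mul_inv_eq_iff_eq_mul.2 h

/-- The Brunetti-Guido-Longo subspace exists, since `U(σ)` is an antiunitary involution that
commutes with the one-parameter group of `x` by `Ad(σ) x = x`. -/
theorem exists_isBGLSubspace (hU : IsAntiunitaryRep ε U) {W : GroupLieAlgebra 𝓘(ℝ, E) G × G}
    (hW : W ∈ wedgeSpace ε) : ∃ V : StandardSubspace K, IsBGLSubspace U W V := by
  set J : K ≃ₗᵢ⋆[ℂ] K := antiunitaryOf (U W.2) (hU.odd _ hW.1)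
  -- the normalization `δ (-t / 2π) = U (exp (t x))` means `δ t = U (exp (-2π t x))`
  set δ : ℝ → K ≃ₗᵢ[ℂ] K := fun t => unitaryOf (U (lieExp ((-(2 * Real.pi) * t) • W.1)))
    (hU.even _ (grading_lieExp ε _ _))
  have hJ : ∀ ξ, J ξ = U W.2 ξ := fun ξ => rfl
  have hδ : ∀ t ξ, δ t ξ = U (lieExp ((-(2 * Real.pi) * t) • W.1)) ξ := fun t ξ => rfl
  have hmul : ∀ (g h : G) (ξ : K), U (g * h) ξ = U g (U h ξ) := fun g h ξ => by
    rw [map_mul]; rfl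
  have hδu : IsUnitaryGroup δ := by
    refine ⟨fun s t ξ => ?_, fun ξ => ?_⟩
    · rw [hδ, hδ, hδ, mul_add, lieExp_add_smul, hmul]
    · simp only [hδ]
      exact (hU.continuous ξ).comp ((continuous_lieExp_smul W.1).comp (by fun_prop))
  have hJJ : ∀ ξ, J (J ξ) = ξ := fun ξ => by
    rw [hJ, hJ, ← hmul, hW.2.1, map_one]; rfl
  have hJδ : ∀ t ξ, J (δ t ξ) = δ t (J ξ) := fun t ξ => by
    have h := lieExp_Ad W.2 W.1 (-(2 * Real.pi) * t)
    rw [hW.2.2, eq_mul_inv_iff_mul_eq] at h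
    rw [hJ, hδ, hδ, hJ, ← hmul, ← hmul, h]
  obtain ⟨V, hV⟩ := exists_isModularPair hδu hJJ hJδ
  refine ⟨V, J, δ, hV, hJ, fun t ξ => ?_⟩
  have ht : -(2 * Real.pi) * (-t / (2 * Real.pi)) = t := by field_simp
  rw [hδ, ht]

theorem IsBGLSubspace.unique {W : GroupLieAlgebra 𝓘(ℝ, E) G × G} {V V' : StandardSubspace K}
    (h : IsBGLSubspace U W V) (h' : IsBGLSubspace U W V') : V = V' := by
  obtain ⟨J, δ, h1, h2, h3⟩ := h
  obtain ⟨J', δ', h1', h2', h3'⟩ := h'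
  have hJ : J = J' := LinearIsometryEquiv.ext fun ξ => by rw [h2, h2']
  have hδ : δ = δ' := by
    funext t
    ext ξ
    have ht : t = -(-(2 * Real.pi) * t) / (2 * Real.pi) := by
      field_simp
    rw [ht, h3, h3']
  subst hJ hδ
  exact h1.standard_unique h1'

/-- The modular group of a Brunetti-Guido-Longo subspace is given by the representation. -/
theorem IsBGLSubspace.modularGroup_eq {W : GroupLieAlgebra 𝓘(ℝ, E) G × G} {V : StandardSubspace K}
    (h : IsBGLSubspace U W V) (t : ℝ) :
    toReal (modularGroup V (-t)) = U (wedgeFlow W (2 * Real.pi * t)) := by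
  obtain ⟨J, δ, h1, -, h3⟩ := h
  refine LinearIsometryEquiv.ext fun ξ => ?_
  have ht : -t = -(2 * Real.pi * t) / (2 * Real.pi) := by field_simp
  rw [h1.modularGroup_eq, ht]
  exact h3 _ ξ

/-- The Brunetti-Guido-Longo construction is equivariant under even elements. -/
theorem IsBGLSubspace.wedgeAct (hU : IsAntiunitaryRep ε U) {W : GroupLieAlgebra 𝓘(ℝ, E) G × G}
    {V : StandardSubspace K} (h : IsBGLSubspace U W V) {g : G} (hg : ε g = 1) :
    IsBGLSubspace U (wedgeAct ε g W) (unitaryImage (unitaryOf (U g) (hU.even g hg)) V) := by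
  obtain ⟨J, δ, h1, h2, h3⟩ := h
  set A := unitaryOf (U g) (hU.even g hg) with hA
  have hmul : ∀ (g h : G) (ξ : K), U (g * h) ξ = U g (U h ξ) := fun g h ξ => by
    rw [map_mul]; rfl
  have hAU : ∀ ξ, A ξ = U g ξ := fun ξ => rfl
  have hAs : ∀ ξ, A.symm ξ = U g⁻¹ ξ := fun ξ => by
    rw [map_inv]; rfl
  refine ⟨A.symm.trans (J.trans A), fun t => A.symm.trans ((δ t).trans A),
    h1.unitaryImage A (fun ξ => by simp) (fun t ξ => by simp), fun ξ => ?_, fun t ξ => ?_⟩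
  · simp only [LinearIsometryEquiv.trans_apply, h2, hAU, hAs, WedgeNet.wedgeAct, hmul]
  · have h4 : lieExp (t • (WedgeNet.wedgeAct ε g W).1) = g * lieExp (t • W.1) * g⁻¹ :=
      wedgeFlow_wedgeAct hg W t
    rw [h4]
    simp only [LinearIsometryEquiv.trans_apply, h3, hAU, hAs, hmul]

/-- An even element that fixes `W` maps the Brunetti-Guido-Longo subspace of `W` onto itself. -/
theorem IsBGLSubspace.mem_stabilizer (hU : IsAntiunitaryRep ε U)
    {W : GroupLieAlgebra 𝓘(ℝ, E) G × G} {V : StandardSubspace K} (h : IsBGLSubspace U W V) {g : G}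
    (hg : ε g = 1) (hW : WedgeNet.wedgeAct ε g W = W) : g ∈ stabilizer U V := by
  have h1 := h.wedgeAct hU hg
  rw [hW] at h1
  have h2 := congrArg StandardSubspace.toClosedSubmodule (h1.unique h)
  exact h2

end BGL

section Stabilizer

variable {G : Type*} [Group G] {K : Type*} [NormedAddCommGroup K] [InnerProductSpace ℂ K]
  [CompleteSpace K] {U : G →* (K ≃ₗᵢ[ℝ] K)}

theorem image_eq_image_iff (V : StandardSubspace K) (g h : G) :
    image (U g) V.toClosedSubmodule = image (U h) V.toClosedSubmodule ↔
      g⁻¹ * h ∈ stabilizer U V := by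
  have h1 : image (U h) V.toClosedSubmodule =
      image (U g) (image (U (g⁻¹ * h)) V.toClosedSubmodule) := by
    rw [← image_mul, ← map_mul, mul_inv_cancel_left]
  rw [h1]
  constructor
  · intro h
    exact ((ClosedSubmodule.mapEquiv _).injective h).symm
  · intro h
    have h' : image (U (g⁻¹ * _)) V.toClosedSubmodule = V.toClosedSubmodule := h
    rw [h']

end Stabilizer

/-! ### Nets on the positive wedge space -/

section Net

variable {E G : Type*} [NormedAddCommGroup E] [NormedSpace ℝ E] [CompleteSpace E]
  [TopologicalSpace G] [T2Space G] [ChartedSpace E G] [Group G] [LieGroup 𝓘(ℝ, E) ∞ G]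
  {F H : Type*} [NormedAddCommGroup F] [NormedSpace ℝ F] [CompleteSpace F]
  [TopologicalSpace H] [T2Space H] [ChartedSpace F H] [Group H] [LieGroup 𝓘(ℝ, F) ∞ H]
  {K : Type*} [NormedAddCommGroup K] [InnerProductSpace ℂ K] [CompleteSpace K]
  {ε : G →* ℤˣ} {ι : H →* G} {U : G →* (K ≃ₗᵢ[ℝ] K)}
  {W₁ : GroupLieAlgebra 𝓘(ℝ, F) H × H} {W₂ : GroupLieAlgebra 𝓘(ℝ, E) G × G}
  {N₂ : StandardSubspace K}

/-- The net `g.W₁ ↦ U(g) N₂` is well defined, since elements fixing `W₁` fix `W₂`, so that they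
leave `N₂` invariant. -/
theorem existsUnique_inducedNet (hU : IsAntiunitaryRep ε U)
    (hstab : ∀ g : H, ε (ι g) = 1 → wedgeAct (ε.comp ι) g W₁ = W₁ → wedgeAct ε (ι g) W₂ = W₂)
    (hN₂ : IsBGLSubspace U W₂ N₂) :
    ∃! N : wedgeOrbit (ε.comp ι) W₁ → StandardSubspace K,
      IsInducedNet (ε.comp ι) (U.comp ι) W₁ N₂ N := by
  refine ⟨fun W => unitaryImage (unitaryOf (U (ι W.2.choose))
    (hU.even _ W.2.choose_spec.1)) N₂, fun g hg => ?_, fun N hN => ?_⟩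
  · have hex : ∃ g' : H, (ε.comp ι) g' = 1 ∧
      wedgeAct (ε.comp ι) g W₁ = wedgeAct (ε.comp ι) g' W₁ := ⟨g, hg, rfl⟩
    obtain ⟨h1, h2⟩ := hex.choose_spec
    set g' := hex.choose
    have h3 : image (U (ι g')) N₂.toClosedSubmodule = image (U (ι g)) N₂.toClosedSubmodule := by
      rw [image_eq_image_iff, ← map_inv, ← map_mul]
      have h4 : (ε.comp ι) (g'⁻¹ * g) = 1 := by rw [map_mul, map_inv, h1, hg]; simp
      refine hN₂.mem_stabilizer hU h4 (hstab _ h4 ?_)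
      rw [wedgeAct_mul, h2, ← wedgeAct_mul, inv_mul_cancel, wedgeAct_one]
    exact h3
  · funext ⟨W, hW⟩
    apply StandardSubspace.toClosedSubmodule_injective
    obtain ⟨h1, h2⟩ := hW.choose_spec
    have h3 := hN hW.choose h1
    have h4 : (⟨wedgeAct (ε.comp ι) hW.choose W₁, hW.choose, h1, rfl⟩ : wedgeOrbit (ε.comp ι) W₁) =
        ⟨W, hW⟩ := Subtype.ext h2.symm
    rw [h4] at h3
    exact h3

/-- For `Wa = a.W₁` and `Wb = b.W₁`, the modular group of `N Wa` acts on `N Wb` by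
`U(a exp(s h₂) a⁻¹)` and the flow of `Wa` acts by `U(a exp(s h₁) a⁻¹)`; these agree if and only if
`g exp(s (h₁ - h₂)) g⁻¹` stabilizes `N₂` for `g = b⁻¹ a`, because the one-parameter groups of `h₁`
and `h₂` commute. -/
theorem isModularCovariant_iff (hU : IsAntiunitaryRep ε U)
    (hι : MDifferentiable 𝓘(ℝ, F) 𝓘(ℝ, E) ι) (hW₁ : W₁ ∈ wedgeSpace (ε.comp ι))
    (hstab : ∀ g : H, ε (ι g) = 1 → wedgeAct (ε.comp ι) g W₁ = W₁ → wedgeAct ε (ι g) W₂ = W₂)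
    (hN₂ : IsBGLSubspace U W₂ N₂) {N : wedgeOrbit (ε.comp ι) W₁ → StandardSubspace K}
    (hN : IsInducedNet (ε.comp ι) (U.comp ι) W₁ N₂ N) :
    IsModularCovariant (ε.comp ι) W₁ N ↔ ∀ (g : H) (t : ℝ), ε (ι g) = 1 →
      ι g * lieExp (t • (lieMap ι W₁.1 - W₂.1)) * (ι g)⁻¹ ∈ stabilizer U N₂ := by
  have hflow : ∀ s : ℝ, ε (ι (wedgeFlow W₁ s)) = 1 := fun s => grading_lieExp (ε.comp ι) W₁.1 s
  have hcomm : ∀ s t : ℝ,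
      Commute (lieExp (E := E) (s • lieMap ι W₁.1)) (lieExp (t • W₂.1)) := fun s t => by
    rw [lieExp_lieMap ι hι]
    exact mul_inv_eq_iff_eq_mul.1
      (conj_wedgeFlow (hflow s) (hstab _ (hflow s) (wedgeAct_wedgeFlow hW₁ s)) t)
  have hsub : ∀ s : ℝ, lieExp (s • (lieMap ι W₁.1 - W₂.1)) =
      (wedgeFlow W₂ s)⁻¹ * ι (wedgeFlow W₁ s) := fun s => by
    rw [lieExp_smul_sub hcomm, (hcomm s (-s)).eq, lieExp_neg_smul, lieExp_lieMap ι hι]; rfl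
  have hNg : ∀ (W : wedgeOrbit (ε.comp ι) W₁) (g : H) (_ : ε (ι g) = 1),
      W.1 = wedgeAct (ε.comp ι) g W₁ →
      (N W).toClosedSubmodule = image (U (ι g)) N₂.toClosedSubmodule := by
    rintro ⟨W, hW⟩ g hg rfl
    exact hN g hg
  have key : ∀ (a b : H) (ha : ε (ι a) = 1) (hb : ε (ι b) = 1) (t : ℝ),
      (∃ h : wedgeAct (ε.comp ι) (wedgeFlow (wedgeAct (ε.comp ι) a W₁) (2 * Real.pi * t))
          (wedgeAct (ε.comp ι) b W₁) ∈ wedgeOrbit (ε.comp ι) W₁,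
        image (toReal (modularGroup (N ⟨wedgeAct (ε.comp ι) a W₁, a, ha, rfl⟩) (-t)))
          (N ⟨wedgeAct (ε.comp ι) b W₁, b, hb, rfl⟩).toClosedSubmodule =
            (N ⟨_, h⟩).toClosedSubmodule)
      ↔ ι (b⁻¹ * a) * lieExp ((2 * Real.pi * t) • (lieMap ι W₁.1 - W₂.1)) * (ι (b⁻¹ * a))⁻¹ ∈
        stabilizer U N₂ := by
    intro a b ha hb t
    set s := 2 * Real.pi * t with hs
    have hfl : ε (ι (wedgeFlow (wedgeAct (ε.comp ι) a W₁) s * b)) = 1 := by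
      rw [wedgeFlow_wedgeAct (ε := ε.comp ι) ha]
      simp [ha, hb, hflow]
    have hmem : wedgeAct (ε.comp ι) (wedgeFlow (wedgeAct (ε.comp ι) a W₁) s)
        (wedgeAct (ε.comp ι) b W₁) ∈ wedgeOrbit (ε.comp ι) W₁ :=
      ⟨_, hfl, (wedgeAct_mul _ _ _).symm⟩
    have hNa : N ⟨wedgeAct (ε.comp ι) a W₁, a, ha, rfl⟩ =
        unitaryImage (unitaryOf (U (ι a)) (hU.even _ ha)) N₂ :=
      StandardSubspace.toClosedSubmodule_injective (hN a ha)
    rw [exists_prop_of_true hmem, hNg ⟨_, hmem⟩ _ hfl (wedgeAct_mul _ _ _).symm,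
      hNg ⟨wedgeAct (ε.comp ι) b W₁, b, hb, rfl⟩ b hb rfl, hNa,
      (hN₂.wedgeAct hU ha).modularGroup_eq, ← image_mul, ← map_mul, image_eq_image_iff,
      wedgeFlow_wedgeAct ha, wedgeFlow_wedgeAct (ε := ε.comp ι) ha, ← hs, hsub]
    have : (ι a * wedgeFlow W₂ s * (ι a)⁻¹ * ι b)⁻¹ * ι (a * wedgeFlow W₁ s * a⁻¹ * b) =
        ι (b⁻¹ * a) * ((wedgeFlow W₂ s)⁻¹ * ι (wedgeFlow W₁ s)) * (ι (b⁻¹ * a))⁻¹ := by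
      simp only [map_mul, map_inv]; group
    rw [this]
  constructor
  · intro h g t hg
    have h1 := (key g 1 hg (by simp) (t / (2 * Real.pi))).1
      (h ⟨_, g, hg, rfl⟩ ⟨_, 1, by simp, rfl⟩ (t / (2 * Real.pi)))
    have h2 : 2 * Real.pi * (t / (2 * Real.pi)) = t := by field_simp
    rwa [h2, inv_one, one_mul] at h1
  · rintro h ⟨_, a, ha, rfl⟩ ⟨_, b, hb, rfl⟩ t
    refine (key a b ha hb t).2 (h _ _ ?_)
    have ha' : ε (ι a) = 1 := ha
    have hb' : ε (ι b) = 1 := hb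
    simp [ha', hb']

end Net

end WedgeNet

end

theorem mainTheorem2
    {E G : Type*} [NormedAddCommGroup E] [NormedSpace ℝ E] [FiniteDimensional ℝ E]
    [TopologicalSpace G] [T2Space G] [ChartedSpace E G] [Group G] [LieGroup 𝓘(ℝ, E) ∞ G]
    {F H : Type*} [NormedAddCommGroup F] [NormedSpace ℝ F] [FiniteDimensional ℝ F]
    [TopologicalSpace H] [T2Space H] [ChartedSpace F H] [Group H] [LieGroup 𝓘(ℝ, F) ∞ H]
    {K : Type*} [NormedAddCommGroup K] [InnerProductSpace ℂ K] [CompleteSpace K]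
    -- the grading of `G`
    (ε : G →* ℤˣ) (hε : Continuous ε)
    -- the graded subgroup `H` of `G`, with the grading `ε ∘ ι`
    (ι : H →* G) (hι : Function.Injective ι) (hι' : ContMDiff 𝓘(ℝ, F) 𝓘(ℝ, E) ∞ ι)
    -- the (anti-)unitary representation of `G`
    (U : G →* (K ≃ₗᵢ[ℝ] K)) (hU : WedgeNet.IsAntiunitaryRep ε U)
    -- the Euler couples `W₁ = (h₁, τ₁)` of `H` and `W₂ = (h₂, τ₂)` of `G`
    (h₁ : GroupLieAlgebra 𝓘(ℝ, F) H) (τ₁ : H)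
    (hW₁ : (h₁, τ₁) ∈ WedgeNet.eulerCouples (ε.comp ι))
    (h₂ : GroupLieAlgebra 𝓘(ℝ, E) G) (τ₂ : G)
    (hW₂ : (h₂, τ₂) ∈ WedgeNet.eulerCouples ε)
    -- the stabilizer of `W₁` in the even part of `H` fixes `W₂`
    (hstab : ∀ g : H, ε (ι g) = 1 →
      WedgeNet.wedgeAct (ε.comp ι) g (h₁, τ₁) = (h₁, τ₁) →
      WedgeNet.wedgeAct ε (ι g) (h₂, τ₂) = (h₂, τ₂)) :
    (∃! N₂ : StandardSubspace K, WedgeNet.IsBGLSubspace U (h₂, τ₂) N₂) ∧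
    ∀ N₂ : StandardSubspace K, WedgeNet.IsBGLSubspace U (h₂, τ₂) N₂ →
      (∃! N : WedgeNet.wedgeOrbit (ε.comp ι) (h₁, τ₁) → StandardSubspace K,
        WedgeNet.IsInducedNet (ε.comp ι) (U.comp ι) (h₁, τ₁) N₂ N) ∧
      ∀ N : WedgeNet.wedgeOrbit (ε.comp ι) (h₁, τ₁) → StandardSubspace K,
        WedgeNet.IsInducedNet (ε.comp ι) (U.comp ι) (h₁, τ₁) N₂ N →
          (WedgeNet.IsModularCovariant (ε.comp ι) (h₁, τ₁) N ↔
            ∀ (g : H) (t : ℝ), ε (ι g) = 1 →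
              WedgeNet.image
                (U (ι g) * U (WedgeNet.lieExp (t • (WedgeNet.lieMap ι h₁ - h₂))) * (U (ι g))⁻¹)
                N₂.toClosedSubmodule = N₂.toClosedSubmodule) ∧
          (WedgeNet.IsModularCovariant (ε.comp ι) (h₁, τ₁) N ↔
            ∀ (g : H) (t : ℝ), ε (ι g) = 1 →
              ι g * WedgeNet.lieExp (t • (WedgeNet.lieMap ι h₁ - h₂)) * (ι g)⁻¹ ∈
                WedgeNet.stabilizer U N₂) := by
  have : CompleteSpace E := FiniteDimensional.complete ℝ E
  have : CompleteSpace F := FiniteDimensional.complete ℝ F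
  obtain ⟨V, hV⟩ := WedgeNet.exists_isBGLSubspace hU hW₂.1
  refine ⟨⟨V, hV, fun V' hV' => hV'.unique hV⟩, fun N₂ hN₂ =>
    ⟨WedgeNet.existsUnique_inducedNet hU hstab hN₂, fun N hN => ?_⟩⟩
  have h := WedgeNet.isModularCovariant_iff hU (hι'.mdifferentiable (by simp)) hW₁.1 hstab hN₂ hN
  refine ⟨?_, h⟩
  rw [h]
  simp only [WedgeNet.stabilizer, Set.mem_ofPred_eq, map_mul, map_inv]
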